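/- Let $p$ be an odd prime, $\omega = e^{2\pi i/p}$, $\mathbb{Z}_p=\mathbb{Z}/p\mathbb{Z}$, and write $|k\rangle = |k{:}Z\rangle$ ($k\in\mathbb{Z}_p$) for the computational basis of the qupit space $\mathbb{C}^p$ and $|k{:}X\rangle = p^{-1/2}\sum_{m\in\mathbb{Z}_p}\omega^{km}|m\rangle$. The space of $n$ qupits is $(\mathbb{C}^p)^{\otimes n}$. **Stabiliser operations.** Let $X|m\rangle=|m+1\rangle$ and $Z|m\rangle=\omega^m|m\rangle$, and let $\mathscr{P}_n$ be the group of operators $\omega^k\bigotimes_{j=1}^n X^{a_j}Z^{b_j}$ with $k,a_j,b_j\in\mathbb{Z}_p$. A unitary $U$ on $n$ qupits is Clifford if $UPU^\dagger\in\mathscr{P}_n$ for all $P\in\mathscr{P}_n$. Let $\mathbb{P}_p=\{(-1)^s\omega^t\mid s,t\in\mathbb{Z}\}$ if $p\equiv1 \bmod 4$ and $\mathbb{P}_p=\{i^s\omega^t\mid s,t\in\mathbb{Z}\}$ if $p\equiv3\bmod 4$, and let $\mathbb{G}_p=\{0\}\cup\{\sqrt{p^r}\,\lambda\mid r\in\mathbb{Z},\lambda\in\mathbb{P}_p\}$.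 The reduced Clifford operators on $n$ qupits are the $\lambda U$ with $\lambda\in\mathbb{P}_p$ and $U$ Clifford with $\det U=1$. A *stabiliser operation* $C:(\mathbb{C}^p)^{\otimes m}\to(\mathbb{C}^p)^{\otimes n}$ is a linear map that is obtained by composition and tensor product from identities, swaps, the state $|0\rangle$, the effect $\langle 0|$, reduced Clifford operators and scalars in $\mathbb{G}_p$, and all of whose matrix entries $\langle x|C|y\rangle$ in the computational basis lie in $\mathbb{G}_p$. **Diagrams.** The diagrams of $\mathsf{ZX}_p^{\mathrm{Stab}}$ are generated under sequential and parallel composition by the identities on $n$ wires and by the generators below, where $x,y\in\mathbb{Z}_p$ are labels. The interpretation $[\![-]\!]$ sends sequential composition to composition of linear maps, parallel composition to the tensor product, identities to identities, and the generators to the following maps (sums over $\mathbb{Z}_p$, with $2^{-1}$ taken in $\mathbb{Z}_p$): - green unit $0\to1$: $\sum_k\omega^{2^{-1}(xk+yk^2)}|k{:}Z\rangle$; green counit $1\to0$: $\sum_k\omega^{2^{-1}(xk+yk^2)}\langle k{:}Z|$; green $1\to 2$: $\sum_k|k,k{:}Z\rangle\langle k{:}Z|$; green $2\to1$: $\sum_k|k{:}Z\rangle\langle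 k,k{:}Z|$; green $1\to1$: $\sum_k|k{:}Z\rangle\langle k{:}Z|$; - red unit $0\to1$: $\sum_k\omega^{2^{-1}(xk+yk^2)}|{-k}{:}X\rangle$; red counit $1\to0$: $\sum_k\omega^{2^{-1}(xk+yk^2)}\langle k{:}X|$; red $1\to 2$: $\sum_k|{-k},{-k}{:}X\rangle\langle k{:}X|$; red $2\to1$: $\sum_k|{-k}{:}X\rangle\langle k,k{:}X|$; antipode $1\to1$: $\sum_k|{-k}{:}X\rangle\langle k{:}X|$; - Hadamard $1\to1$: $\sum_k|k{:}X\rangle\langle k{:}Z|$; cup $0\to2$: $\sum_k|k,k{:}Z\rangle$; cap $2\to0$: $\sum_k\langle k,k{:}Z|$; braid $2\to2$: $\sum_{k,\ell}|k,\ell{:}Z\rangle\langle\ell,k{:}Z|$; $\star:0\to0$: $-1$. **Theorem (Universality).** For all $m,n\in\mathbb{N}$, the interpretation of every diagram $m\to n$ is a stabiliser operation, and for every stabiliser operation $C:(\mathbb{C}^p)^{\otimes m}\to(\mathbb{C}^p)^{\otimes n}$ there is a diagram $D:m\to n$ with $[\![D]\!]=C$. That is, the interpretation co-restricts to the category $\mathsf{Stab}_p$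 of stabiliser operations, and this co-restriction is full. -/

import Mathlib

noncomputable section

namespace QupitZX

/-- The computational basis of `n` qupits. -/
abbrev Basis (p n : ℕ) : Type := Fin n → ZMod p

/-- Linear maps from `m` qupits to `n` qupits, as matrices in the computational basis:
the entry at `(x, y)` is the amplitude `⟨x|M|y⟩`. -/
abbrev Op (p m n : ℕ) : Type := Matrix (Basis p n) (Basis p m) ℂ

section Basics

variable (p : ℕ) [Fact p.Prime]

/-- `ω = exp(2πi/p)`. -/
def omega : ℂ := Complex.exp (2 * Real.pi * Complex.I / p)

/-- `ω ^ a` for an exponent `a` modulo `p`. -/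
def omegaPow (a : ZMod p) : ℂ := omega p ^ a.val

/-- Exponents of `ω` may be computed modulo `p`: `omegaPow` is the standard additive character. -/
theorem omegaPow_eq_stdAddChar (a : ZMod p) : omegaPow p a = ZMod.stdAddChar a := by
  rw [omegaPow, omega, ← Complex.exp_nat_mul, ZMod.stdAddChar_apply, ZMod.toCircle_apply]
  congr 1
  ring

/-- The group of phases `ℙ_p`: `(-1)^s ω^t` if `p ≡ 1 mod 4`, and `i^s ω^t` if `p ≡ 3 mod 4`. -/
def phaseGroup : Set ℂ :=
  {z | ∃ s t : ℤ, z = (if p % 4 = 1 then -1 else Complex.I) ^ s * omega p ^ t}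

/-- The monoid of scalars `𝔾_p = {0} ∪ {√(p^r) λ | r ∈ ℤ, λ ∈ ℙ_p}`. -/
def scalarMonoid : Set ℂ :=
  {z | z = 0 ∨ ∃ r : ℤ, ∃ l ∈ phaseGroup p, z = (Real.sqrt ((p : ℝ) ^ r) : ℂ) * l}

/-- The vector `|k : Z⟩ = |k⟩`. -/
def ketZ (k : ZMod p) : ZMod p → ℂ := Pi.single k 1

/-- The vector `|k : X⟩ = H|k⟩ = p^{-1/2} ∑ₘ ω^{km} |m⟩`. -/
def ketX (k : ZMod p) : ZMod p → ℂ := fun m => omegaPow p (k * m) / (Real.sqrt p : ℂ)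

variable {p}

/-- The `n`-fold tensor power `v ⊗ ⋯ ⊗ v` of a one-qupit vector. -/
def ketPow (n : ℕ) (v : ZMod p → ℂ) : Basis p n → ℂ := fun x => ∏ i, v (x i)

/-- The operator `|u⟩⟨v|`. -/
def dyad {m n : ℕ} (u : Basis p n → ℂ) (v : Basis p m → ℂ) : Op p m n :=
  Matrix.vecMulVec u (star v)

/-- The tensor product of two operators. -/
def tensorOp {m n m' n' : ℕ} (A : Op p m n) (B : Op p m' n') : Op p (m + m') (n + n') :=
  Matrix.of fun x y =>
    A (fun i => x (Fin.castAdd n' i)) (fun i => y (Fin.castAdd m' i)) *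
      B (fun i => x (Fin.natAdd n i)) (fun i => y (Fin.natAdd m i))

variable (p) in
/-- The swap `∑_{k,l} |k,l⟩⟨l,k|` of two qupits. -/
def swapOp : Op p 2 2 :=
  ∑ k : ZMod p, ∑ l : ZMod p, dyad (Pi.single ![k, l] 1) (Pi.single ![l, k] 1)

/-- A scalar, as an operator from zero qupits to zero qupits. -/
def scalarOp (z : ℂ) : Op p 0 0 := Matrix.of fun _ _ => z

end Basics

section Stabiliser

variable {p : ℕ} [Fact p.Prime]

/-- The Pauli operator `ω^k X^{a₁}Z^{b₁} ⊗ ⋯ ⊗ X^{aₙ}Z^{bₙ}`, where `X|m⟩ = |m+1⟩` and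
`Z|m⟩ = ω^m|m⟩`; it maps `|y⟩` to `ω^{k + b·y} |y + a⟩`. -/
def pauli {n : ℕ} (k : ZMod p) (a b : Basis p n) : Op p n n :=
  Matrix.of fun x y => if x = y + a then omegaPow p (k + b ⬝ᵥ y) else 0

variable (p) in
/-- The generalised Pauli group on `n` qupits. -/
def pauliGroup (n : ℕ) : Set (Op p n n) := {P | ∃ k a b, P = pauli k a b}

/-- The Clifford operators: the unitaries `U` such that `U P U†` is Pauli for every Pauli `P`. -/
def IsClifford {n : ℕ} (U : Op p n n) : Prop :=
  U ∈ Matrix.unitaryGroup (Basis p n) ℂ ∧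
    ∀ P ∈ pauliGroup p n, U * P * U.conjTranspose ∈ pauliGroup p n

variable (p) in
/-- The reduced Clifford operators `λU`, with `λ ∈ ℙ_p` and `U` Clifford and special unitary. -/
def reducedClifford (n : ℕ) : Set (Op p n n) :=
  {M | ∃ l ∈ phaseGroup p, ∃ U : Op p n n, IsClifford U ∧ U.det = 1 ∧ M = l • U}

/-- The operators obtained by sequential and parallel composition (including identities and swaps)
from the computational basis state `|0⟩`, the effect `⟨0|`, reduced Clifford operators, and
scalars in `𝔾_p`. -/
inductive Generated : {m n : ℕ} → Op p m n → Prop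
  | id (n : ℕ) : Generated (1 : Op p n n)
  | swap : Generated (swapOp p)
  | state : Generated (dyad (ketPow 1 (ketZ p 0)) (ketPow 0 (ketZ p 0)) : Op p 0 1)
  | effect : Generated (dyad (ketPow 0 (ketZ p 0)) (ketPow 1 (ketZ p 0)) : Op p 1 0)
  | clifford {n : ℕ} (U : Op p n n) (hU : U ∈ reducedClifford p n) : Generated U
  | scalar (z : ℂ) (hz : z ∈ scalarMonoid p) : Generated (scalarOp z : Op p 0 0)
  | comp {m n k : ℕ} (A : Op p m n) (B : Op p n k) (hA : Generated A) (hB : Generated B) :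
      Generated (B * A)
  | tensor {m n m' n' : ℕ} (A : Op p m n) (B : Op p m' n')
      (hA : Generated A) (hB : Generated B) : Generated (tensorOp A B)

/-- The morphisms of `Stab_p`: the operators built from the generators above, with scalars in
`𝔾_p`, that is, all of whose amplitudes `⟨x|C|y⟩` belong to `𝔾_p`.

The condition on amplitudes is not automatic. The special unitary Clifford operators include the
scalar `exp(2πi/p^n)` on `n` qupits, which is outside `ℙ_p` as soon as `n ≥ 2`. -/
def IsStabiliserOperation {m n : ℕ} (C : Op p m n) : Prop :=
  Generated C ∧ ∀ x y, C x y ∈ scalarMonoid p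

end Stabiliser

/-- The diagrams with `m` inputs and `n` outputs. The identity on `n` wires is the empty diagram
for `n = 0` and the plain wire for `n = 1`. -/
inductive Diagram (p : ℕ) : ℕ → ℕ → Type
  | id (n : ℕ) : Diagram p n n
  | braid : Diagram p 2 2
  | cup : Diagram p 0 2
  | cap : Diagram p 2 0
  | hadamard : Diagram p 1 1
  | star : Diagram p 0 0
  | greenId : Diagram p 1 1
  | greenUnit (x y : ZMod p) : Diagram p 0 1
  | greenCounit (x y : ZMod p) : Diagram p 1 0
  | greenMult : Diagram p 2 1
  | greenComult : Diagram p 1 2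
  | antipode : Diagram p 1 1
  | redUnit (x y : ZMod p) : Diagram p 0 1
  | redCounit (x y : ZMod p) : Diagram p 1 0
  | redMult : Diagram p 2 1
  | redComult : Diagram p 1 2
  | comp {m n k : ℕ} (D : Diagram p m n) (E : Diagram p n k) : Diagram p m k
  | tensor {m n m' n' : ℕ} (D : Diagram p m n) (E : Diagram p m' n') :
      Diagram p (m + m') (n + n')

section Interpretation

variable {p : ℕ} [Fact p.Prime]

/-- The phase `ω^{2⁻¹(xk + yk²)}` of a spider with label `(x, y)`. -/
def spiderPhase (x y k : ZMod p) : ℂ := omegaPow p (2⁻¹ * (x * k + y * k ^ 2))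

/-- The map `∑ₖ ω^{2⁻¹(xk + yk²)} |k:Z⟩^{⊗n} ⟨k:Z|^{⊗m}`. -/
def greenOp (m n : ℕ) (x y : ZMod p) : Op p m n :=
  ∑ k : ZMod p, spiderPhase x y k • dyad (ketPow n (ketZ p k)) (ketPow m (ketZ p k))

/-- The map `∑ₖ ω^{2⁻¹(xk + yk²)} |-k:X⟩^{⊗n} ⟨k:X|^{⊗m}`. -/
def redOp (m n : ℕ) (x y : ZMod p) : Op p m n :=
  ∑ k : ZMod p, spiderPhase x y k • dyad (ketPow n (ketX p (-k))) (ketPow m (ketX p k))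

/-- The standard interpretation of diagrams. -/
def interp : {m n : ℕ} → Diagram p m n → Op p m n
  | _, _, .id _ => 1
  | _, _, .braid => swapOp p
  | _, _, .cup => greenOp 0 2 0 0
  | _, _, .cap => greenOp 2 0 0 0
  | _, _, .hadamard => ∑ k : ZMod p, dyad (ketPow 1 (ketX p k)) (ketPow 1 (ketZ p k))
  | _, _, .star => scalarOp (-1)
  | _, _, .greenId => greenOp 1 1 0 0
  | _, _, .greenUnit x y => greenOp 0 1 x y
  | _, _, .greenCounit x y => greenOp 1 0 x y
  | _, _, .greenMult => greenOp 2 1 0 0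
  | _, _, .greenComult => greenOp 1 2 0 0
  | _, _, .antipode => redOp 1 1 0 0
  | _, _, .redUnit x y => redOp 0 1 x y
  | _, _, .redCounit x y => redOp 1 0 x y
  | _, _, .redMult => redOp 2 1 0 0
  | _, _, .redComult => redOp 1 2 0 0
  | _, _, .comp D E => interp E * interp D
  | _, _, .tensor D E => tensorOp (interp D) (interp E)

end Interpretation

end QupitZX

end

noncomputable section

namespace QupitZX

open Finset

section Scalars

variable {p : ℕ} [Fact p.Prime]

theorem omegaPow_zero : omegaPow p 0 = 1 := by simp [omegaPow]

theorem omegaPow_add (a b : ZMod p) : omegaPow p (a + b) = omegaPow p a * omegaPow p b := by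
  simp [omegaPow_eq_stdAddChar, AddChar.map_add_eq_mul]

theorem omegaPow_sum {ι : Type*} (s : Finset ι) (f : ι → ZMod p) :
    omegaPow p (∑ i ∈ s, f i) = ∏ i ∈ s, omegaPow p (f i) := by
  classical
  induction s using Finset.induction_on with
  | empty => simp [omegaPow_zero]
  | insert a s ha ih => rw [sum_insert ha, prod_insert ha, omegaPow_add, ih]

theorem omegaPow_ne_zero (a : ZMod p) : omegaPow p a ≠ 0 := by
  intro h
  have := omegaPow_add a (-a)
  rw [add_neg_cancel, omegaPow_zero, h, zero_mul] at this
  exact one_ne_zero this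

theorem omegaPow_neg (a : ZMod p) : omegaPow p (-a) = (omegaPow p a)⁻¹ := by
  refine eq_inv_of_mul_eq_one_left ?_
  rw [← omegaPow_add, neg_add_cancel, omegaPow_zero]

theorem omegaPow_injective : Function.Injective (omegaPow p) := by
  intro a b h
  rw [omegaPow_eq_stdAddChar, omegaPow_eq_stdAddChar] at h
  exact ZMod.injective_stdAddChar h

theorem star_omegaPow (a : ZMod p) : star (omegaPow p a) = omegaPow p (-a) := by
  rw [omegaPow_neg, omegaPow_eq_stdAddChar, ZMod.stdAddChar_apply]
  exact (Circle.coe_inv_eq_conj _).symm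

theorem sum_omegaPow_mul (a : ZMod p) :
    ∑ k : ZMod p, omegaPow p (k * a) = if a = 0 then (p : ℂ) else 0 := by
  simp only [omegaPow_eq_stdAddChar]
  rw [AddChar.sum_mulShift a (ZMod.isPrimitive_stdAddChar p), ZMod.card]
  split_ifs <;> simp

theorem omega_zpow (t : ℤ) : omega p ^ t = omegaPow p t := by
  have h : omega p = omegaPow p 1 := by
    have := Fact.out (p := p.Prime).one_lt
    have : Fact (1 < p) := ⟨this⟩
    simp [omegaPow, ZMod.val_one]
  rw [h, omegaPow_eq_stdAddChar, omegaPow_eq_stdAddChar, ← AddChar.map_zsmul_eq_zpow]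
  simp

variable (p) in
/-- The generator of the phases of `ℙ_p` of order prime to `p`. -/
def phaseUnit : ℂ := if p % 4 = 1 then -1 else Complex.I

theorem phaseUnit_ne_zero : phaseUnit p ≠ 0 := by
  unfold phaseUnit; split_ifs <;> simp

theorem mem_phaseGroup_iff {z : ℂ} :
    z ∈ phaseGroup p ↔ ∃ (s : ℤ) (a : ZMod p), z = phaseUnit p ^ s * omegaPow p a := by
  constructor
  · rintro ⟨s, t, h⟩
    exact ⟨s, t, by rw [h, omega_zpow]; rfl⟩
  · rintro ⟨s, a, h⟩
    refine ⟨s, a.val, ?_⟩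
    rw [h, omega_zpow]
    simp [phaseUnit]

theorem phaseGroup_mul {z w : ℂ} (hz : z ∈ phaseGroup p) (hw : w ∈ phaseGroup p) :
    z * w ∈ phaseGroup p := by
  rw [mem_phaseGroup_iff] at *
  obtain ⟨s, a, rfl⟩ := hz
  obtain ⟨t, b, rfl⟩ := hw
  refine ⟨s + t, a + b, ?_⟩
  rw [zpow_add₀ phaseUnit_ne_zero, omegaPow_add]
  ring

theorem phaseGroup_inv {z : ℂ} (hz : z ∈ phaseGroup p) : z⁻¹ ∈ phaseGroup p := by
  rw [mem_phaseGroup_iff] at *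
  obtain ⟨s, a, rfl⟩ := hz
  refine ⟨-s, -a, ?_⟩
  rw [zpow_neg, omegaPow_neg, mul_inv]

theorem omegaPow_mem_phaseGroup (a : ZMod p) : omegaPow p a ∈ phaseGroup p :=
  mem_phaseGroup_iff.2 ⟨0, a, by simp⟩

theorem one_mem_phaseGroup : (1 : ℂ) ∈ phaseGroup p := by
  simpa [omegaPow_zero] using omegaPow_mem_phaseGroup (0 : ZMod p)

theorem neg_one_mem_phaseGroup : (-1 : ℂ) ∈ phaseGroup p := by
  rw [mem_phaseGroup_iff]
  by_cases h : p % 4 = 1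
  · exact ⟨1, 0, by simp [phaseUnit, h, omegaPow_zero]⟩
  · exact ⟨2, 0, by simp [phaseUnit, h, omegaPow_zero]⟩

theorem I_mem_phaseGroup (h : p % 4 = 3) : Complex.I ∈ phaseGroup p :=
  mem_phaseGroup_iff.2 ⟨1, 0, by simp [phaseUnit, h, omegaPow_zero]⟩

theorem prime_pos_real : (0 : ℝ) < p := by exact_mod_cast (Fact.out : p.Prime).pos

variable (p) in
/-- The complex number `√p`. -/
def sqrtP : ℂ := (Real.sqrt p : ℂ)

theorem sqrtP_ne_zero : sqrtP p ≠ 0 := by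
  simp [sqrtP, (Real.sqrt_pos.2 (prime_pos_real (p := p))).ne']

theorem sqrtP_mul_self : sqrtP p * sqrtP p = p := by
  rw [sqrtP, ← Complex.ofReal_mul, Real.mul_self_sqrt prime_pos_real.le]
  simp

theorem sqrt_zpow (r : ℤ) : (Real.sqrt ((p : ℝ) ^ r) : ℂ) = sqrtP p ^ r := by
  have : Real.sqrt ((p : ℝ) ^ r) = Real.sqrt p ^ r := by
    rw [Real.sqrt_eq_iff_mul_self_eq (zpow_nonneg prime_pos_real.le _)
      (zpow_nonneg (Real.sqrt_nonneg _) _), ← mul_zpow, Real.mul_self_sqrt prime_pos_real.le]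
  rw [this, sqrtP, Complex.ofReal_zpow]

theorem mem_scalarMonoid_iff {z : ℂ} :
    z ∈ scalarMonoid p ↔ z = 0 ∨ ∃ r : ℤ, ∃ l ∈ phaseGroup p, z = sqrtP p ^ r * l := by
  simp only [scalarMonoid, Set.mem_ofPred_eq, sqrt_zpow]

theorem zero_mem_scalarMonoid : (0 : ℂ) ∈ scalarMonoid p := Or.inl rfl

theorem mem_scalarMonoid_of_phase {z : ℂ} (hz : z ∈ phaseGroup p) : z ∈ scalarMonoid p :=
  mem_scalarMonoid_iff.2 (Or.inr ⟨0, z, hz, by simp⟩)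

theorem one_mem_scalarMonoid : (1 : ℂ) ∈ scalarMonoid p :=
  mem_scalarMonoid_of_phase one_mem_phaseGroup

theorem neg_one_mem_scalarMonoid : (-1 : ℂ) ∈ scalarMonoid p :=
  mem_scalarMonoid_of_phase neg_one_mem_phaseGroup

theorem omegaPow_mem_scalarMonoid (a : ZMod p) : omegaPow p a ∈ scalarMonoid p :=
  mem_scalarMonoid_of_phase (omegaPow_mem_phaseGroup a)

theorem scalarMonoid_mul {z w : ℂ} (hz : z ∈ scalarMonoid p) (hw : w ∈ scalarMonoid p) :
    z * w ∈ scalarMonoid p := by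
  rw [mem_scalarMonoid_iff] at *
  rcases hz with rfl | ⟨r, l, hl, rfl⟩
  · simp
  rcases hw with rfl | ⟨r', l', hl', rfl⟩
  · simp
  refine Or.inr ⟨r + r', l * l', phaseGroup_mul hl hl', ?_⟩
  rw [zpow_add₀ sqrtP_ne_zero]
  ring

theorem scalarMonoid_inv {z : ℂ} (hz : z ∈ scalarMonoid p) : z⁻¹ ∈ scalarMonoid p := by
  rw [mem_scalarMonoid_iff] at *
  rcases hz with rfl | ⟨r, l, hl, rfl⟩
  · simp
  exact Or.inr ⟨-r, l⁻¹, phaseGroup_inv hl, by rw [zpow_neg, mul_inv]⟩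

theorem scalarMonoid_pow {z : ℂ} (hz : z ∈ scalarMonoid p) (n : ℕ) : z ^ n ∈ scalarMonoid p := by
  induction n with
  | zero => simpa using one_mem_scalarMonoid
  | succ n ih => rw [pow_succ]; exact scalarMonoid_mul ih hz

theorem scalarMonoid_prod {ι : Type*} (s : Finset ι) (f : ι → ℂ)
    (h : ∀ i ∈ s, f i ∈ scalarMonoid p) : ∏ i ∈ s, f i ∈ scalarMonoid p := by
  classical
  induction s using Finset.induction_on with
  | empty => simpa using one_mem_scalarMonoid
  | insert a s ha ih =>
    rw [prod_insert ha]
    exact scalarMonoid_mul (h a (by simp)) (ih fun i hi => h i (by simp [hi]))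

theorem sqrtP_mem_scalarMonoid : sqrtP p ∈ scalarMonoid p :=
  mem_scalarMonoid_iff.2 (Or.inr ⟨1, 1, one_mem_phaseGroup, by simp⟩)

theorem prime_mem_scalarMonoid : (p : ℂ) ∈ scalarMonoid p := by
  rw [← sqrtP_mul_self]
  exact scalarMonoid_mul sqrtP_mem_scalarMonoid sqrtP_mem_scalarMonoid

end Scalars

section GaussSum

variable {p : ℕ} [Fact p.Prime]

theorem two_ne_zero_zmod (hp : p ≠ 2) : (2 : ZMod p) ≠ 0 := by
  intro h
  have h2 : ((2 : ℕ) : ZMod p) = 0 := by exact_mod_cast h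
  rw [ZMod.natCast_eq_zero_iff] at h2
  exact hp ((Nat.prime_dvd_prime_iff_eq Fact.out Nat.prime_two).1 h2)

theorem sum_omegaPow_sq_eq_gaussSum (hp : p ≠ 2) {a : ZMod p} (ha : a ≠ 0) :
    ∑ k : ZMod p, omegaPow p (a * k ^ 2) =
      gaussSum ((quadraticChar (ZMod p)).ringHomComp (Int.castRingHom ℂ))
        (ZMod.stdAddChar.mulShift a) := by
  have hF : ringChar (ZMod p) ≠ 2 := by rwa [ZMod.ringChar_zmod_n]
  have hcard : ∀ t : ZMod p, ((#{k : ZMod p | k ^ 2 = t} : ℕ) : ℂ) =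
      (quadraticChar (ZMod p) t : ℂ) + 1 := by
    intro t
    have := quadraticChar_card_sqrts hF t
    rw [Set.toFinset_ofPred] at this
    exact_mod_cast this
  have h0 : ∑ t : ZMod p, omegaPow p (a * t) = 0 := by
    have := sum_omegaPow_mul a
    rw [if_neg ha] at this
    simpa only [mul_comm] using this
  calc ∑ k : ZMod p, omegaPow p (a * k ^ 2)
      = ∑ t : ZMod p, ∑ k : ZMod p with k ^ 2 = t, omegaPow p (a * k ^ 2) :=
        (sum_fiberwise _ _ _).symm
    _ = ∑ t : ZMod p, ((quadraticChar (ZMod p) t : ℂ) + 1) * omegaPow p (a * t) := by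
        refine sum_congr rfl fun t _ => ?_
        rw [← hcard, ← nsmul_eq_mul]
        refine sum_eq_card_nsmul fun k hk => ?_
        rw [(mem_filter.1 hk).2]
    _ = _ := by
        simp only [add_mul, sum_add_distrib, one_mul, h0, add_zero]
        refine sum_congr rfl fun t _ => ?_
        rw [omegaPow_eq_stdAddChar]
        rfl

theorem sum_omegaPow_sq_sq (hp : p ≠ 2) {a : ZMod p} (ha : a ≠ 0) :
    (∑ k : ZMod p, omegaPow p (a * k ^ 2)) ^ 2 = if p % 4 = 1 then (p : ℂ) else -p := by
  have hF : ringChar (ZMod p) ≠ 2 := by rwa [ZMod.ringChar_zmod_n]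
  have hinj : Function.Injective (Int.castRingHom ℂ) := Int.cast_injective
  rw [sum_omegaPow_sq_eq_gaussSum hp ha, gaussSum_sq
    ((MulChar.ringHomComp_ne_one_iff hinj).2 (quadraticChar_ne_one hF))
    ((quadraticChar_isQuadratic _).comp _)
    (AddChar.IsPrimitive.of_ne_one (ZMod.isPrimitive_stdAddChar p ha))]
  rw [MulChar.ringHomComp_apply, quadraticChar_neg_one hF, ZMod.card]
  have h1 := (Fact.out : p.Prime).eq_one_or_self_of_dvd 2
  split_ifs with h
  · rw [ZMod.χ₄_nat_one_mod_four h]; simp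
  · rw [ZMod.χ₄_nat_three_mod_four (by omega)]; simp

theorem mod_four_eq_three (hp : p ≠ 2) (h : p % 4 ≠ 1) : p % 4 = 3 := by
  have h1 := (Fact.out : p.Prime).eq_one_or_self_of_dvd 2
  omega

theorem sum_omegaPow_sq_mem_scalarMonoid (hp : p ≠ 2) (a b : ZMod p) :
    ∑ k : ZMod p, omegaPow p (a * k ^ 2 + b * k) ∈ scalarMonoid p := by
  by_cases ha : a = 0
  · subst ha
    have := sum_omegaPow_mul b
    simp only [mul_comm _ b] at this
    simp only [zero_mul, zero_add, this]
    split_ifs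
    exacts [prime_mem_scalarMonoid, zero_mem_scalarMonoid]
  have h2 := two_ne_zero_zmod hp
  have hsq : ∑ k : ZMod p, omegaPow p (a * k ^ 2 + b * k) =
      omegaPow p (-(b ^ 2 / (4 * a))) * ∑ k : ZMod p, omegaPow p (a * k ^ 2) := by
    rw [mul_sum, ← Equiv.sum_comp (Equiv.addRight (b / (2 * a))) fun k =>
      omegaPow p (-(b ^ 2 / (4 * a))) * omegaPow p (a * k ^ 2)]
    refine sum_congr rfl fun k _ => ?_
    rw [← omegaPow_add]
    congr 1
    have h4 : (4 : ZMod p) ≠ 0 := by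
      rw [show (4 : ZMod p) = 2 * 2 by norm_num]; exact mul_ne_zero h2 h2
    simp only [Equiv.coe_addRight]
    field_simp
    ring
  rw [hsq]
  refine scalarMonoid_mul (omegaPow_mem_scalarMonoid _) ?_
  have h := sum_omegaPow_sq_sq hp ha
  set g := ∑ k : ZMod p, omegaPow p (a * k ^ 2)
  rw [← sqrtP_mul_self] at h
  split_ifs at h with h4
  · rw [← pow_two, sq_eq_sq_iff_eq_or_eq_neg] at h
    rcases h with h | h <;> rw [h]
    · exact sqrtP_mem_scalarMonoid
    · rw [neg_eq_neg_one_mul]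
      exact scalarMonoid_mul neg_one_mem_scalarMonoid sqrtP_mem_scalarMonoid
  · have hI := mem_scalarMonoid_of_phase (I_mem_phaseGroup (mod_four_eq_three hp h4))
    have : g ^ 2 = (Complex.I * sqrtP p) ^ 2 := by rw [h, mul_pow, Complex.I_sq]; ring
    rw [sq_eq_sq_iff_eq_or_eq_neg] at this
    rcases this with h | h <;> rw [h]
    · exact scalarMonoid_mul hI sqrtP_mem_scalarMonoid
    · rw [neg_eq_neg_one_mul]
      exact scalarMonoid_mul neg_one_mem_scalarMonoid (scalarMonoid_mul hI sqrtP_mem_scalarMonoid)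

end GaussSum

section Quadratic

variable {p : ℕ} [Fact p.Prime] {V W : Type} [AddCommGroup V] [Module (ZMod p) V]
  [AddCommGroup W] [Module (ZMod p) W]

/-- Polynomial functions of degree at most two. -/
def IsQuadratic (q : V → ZMod p) : Prop :=
  ∃ (Q : QuadraticForm (ZMod p) V) (l : Module.Dual (ZMod p) V) (c : ZMod p),
    ∀ v, q v = Q v + l v + c

theorem IsQuadratic.add {q r : V → ZMod p} (hq : IsQuadratic q) (hr : IsQuadratic r) :
    IsQuadratic fun v => q v + r v := by
  obtain ⟨Q, l, c, h⟩ := hq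
  obtain ⟨Q', l', c', h'⟩ := hr
  refine ⟨Q + Q', l + l', c + c', fun v => ?_⟩
  simp only [h, h', _root_.add_apply, LinearMap.add_apply]
  ring

theorem IsQuadratic.smul (a : ZMod p) {q : V → ZMod p} (hq : IsQuadratic q) :
    IsQuadratic fun v => a * q v := by
  obtain ⟨Q, l, c, h⟩ := hq
  refine ⟨a • Q, a • l, a * c, fun v => ?_⟩
  simp only [h, _root_.smul_apply, LinearMap.smul_apply, smul_eq_mul]
  ring

theorem IsQuadratic.neg {q : V → ZMod p} (hq : IsQuadratic q) : IsQuadratic fun v => -q v := by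
  simpa using hq.smul (-1)

theorem IsQuadratic.const (c : ZMod p) : IsQuadratic fun _ : V => c :=
  ⟨0, 0, c, by simp⟩

theorem IsQuadratic.linear (l : V →ₗ[ZMod p] ZMod p) : IsQuadratic fun v => l v :=
  ⟨0, l, 0, by simp⟩

theorem IsQuadratic.linear_mul (l m : V →ₗ[ZMod p] ZMod p) : IsQuadratic fun v => l v * m v :=
  ⟨QuadraticMap.linMulLin l m, 0, 0, by simp⟩

theorem IsQuadratic.sum {ι : Type*} (s : Finset ι) {q : ι → V → ZMod p}
    (h : ∀ i, IsQuadratic (q i)) : IsQuadratic fun v => ∑ i ∈ s, q i v := by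
  classical
  induction s using Finset.induction_on with
  | empty => simpa using IsQuadratic.const 0
  | insert a s ha ih => simpa only [sum_insert ha] using (h a).add ih

theorem IsQuadratic.comp {q : V → ZMod p} (hq : IsQuadratic q) (f : W →ₗ[ZMod p] V) :
    IsQuadratic fun w => q (f w) := by
  obtain ⟨Q, l, c, h⟩ := hq
  exact ⟨Q.comp f, l.comp f, c, fun v => by simp [h]⟩

theorem IsQuadratic.translate {q : V → ZMod p} (hq : IsQuadratic q) (v₀ : V) :
    IsQuadratic fun v => q (v₀ + v) := by
  obtain ⟨Q, l, c, h⟩ := hq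
  refine ⟨Q, l + Q.polarBilin v₀, Q v₀ + l v₀ + c, fun v => ?_⟩
  simp only [h, map_add, LinearMap.add_apply, QuadraticMap.polarBilin_apply_apply,
    QuadraticMap.polar]
  ring

theorem sum_omegaPow_isQuadratic_mem [Fintype W] (hp : p ≠ 2) {q : W → ZMod p}
    (hq : IsQuadratic q) : ∑ w, omegaPow p (q w) ∈ scalarMonoid p := by
  obtain ⟨Q, l, c, h⟩ := hq
  have h2 := two_ne_zero_zmod hp
  let _ : Invertible (2 : ZMod p) := invertibleOfNonzero h2
  obtain ⟨a, ⟨e⟩⟩ := Q.equivalent_weightedSumSquares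
  set b := fun i => l (e.toLinearEquiv.symm fun j => if i = j then 1 else 0)
  have hq : ∀ x, q (e.toLinearEquiv.symm x) = ∑ i, (a i * x i ^ 2 + b i * x i) + c := by
    intro x
    rw [h, sum_add_distrib]
    congr 2
    · have := e.map_app (e.toLinearEquiv.symm x)
      rw [← this]
      have hx : e (e.toLinearEquiv.symm x) = x := e.toLinearEquiv.apply_symm_apply x
      rw [hx, QuadraticMap.weightedSumSquares_apply]
      simp [pow_two]
    · have := LinearMap.pi_apply_eq_sum_univ (l.comp e.toLinearEquiv.symm.toLinearMap) x
      simp only [smul_eq_mul, mul_comm (x _)] at this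
      exact this
  rw [← e.toLinearEquiv.symm.toEquiv.sum_comp]
  have : ∀ x, omegaPow p (q (e.toLinearEquiv.symm.toEquiv x)) =
      (∏ i, omegaPow p (a i * x i ^ 2 + b i * x i)) * omegaPow p c := by
    intro x
    rw [← omegaPow_sum, ← omegaPow_add, ← hq]
    rfl
  simp only [this]
  rw [← sum_mul]
  refine scalarMonoid_mul ?_ (omegaPow_mem_scalarMonoid _)
  have hprod := prod_univ_sum (fun _ => (univ : Finset (ZMod p)))
    fun i k => omegaPow p (a i * k ^ 2 + b i * k)
  rw [Fintype.piFinset_univ] at hprod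
  rw [← hprod]
  exact scalarMonoid_prod _ _ fun i _ => sum_omegaPow_sq_mem_scalarMonoid hp _ _

end Quadratic

section Gaussian

variable {p : ℕ} [Fact p.Prime] {V V' : Type} [AddCommGroup V] [Module (ZMod p) V]
  [AddCommGroup V'] [Module (ZMod p) V']

variable (p) in
/-- Quadratic exponential sums `v ↦ c ∑_w ω^{q(v,w)}`, where `q` has degree at most two and
`c ∈ 𝔾_p`. -/
def IsGaussian (f : V → ℂ) : Prop :=
  ∃ (W : Type) (_ : AddCommGroup W) (_ : Module (ZMod p) W) (_ : Fintype W) (c : ℂ)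
    (q : V × W → ZMod p), c ∈ scalarMonoid p ∧ IsQuadratic q ∧
      ∀ v, f v = c * ∑ w, omegaPow p (q (v, w))

theorem IsGaussian.mem_scalarMonoid (hp : p ≠ 2) {f : V → ℂ} (hf : IsGaussian p f) (v : V) :
    f v ∈ scalarMonoid p := by
  obtain ⟨W, _, _, _, c, q, hc, hq, h⟩ := hf
  rw [h]
  refine scalarMonoid_mul hc (sum_omegaPow_isQuadratic_mem hp ?_)
  have := (hq.translate (v, 0)).comp (LinearMap.inr (ZMod p) V W)
  simpa using this

theorem IsGaussian.comp {f : V → ℂ} (hf : IsGaussian p f) (g : V' →ₗ[ZMod p] V) :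
    IsGaussian p fun v => f (g v) := by
  obtain ⟨W, _, _, _, c, q, hc, hq, h⟩ := hf
  exact ⟨W, _, _, inferInstance, c, _, hc, hq.comp (g.prodMap LinearMap.id), fun v => h _⟩

theorem IsGaussian.mul {f g : V → ℂ} (hf : IsGaussian p f) (hg : IsGaussian p g) :
    IsGaussian p fun v => f v * g v := by
  obtain ⟨W, _, _, _, c, q, hc, hq, h⟩ := hf
  obtain ⟨W', _, _, _, c', q', hc', hq', h'⟩ := hg
  refine ⟨W × W', inferInstance, inferInstance, inferInstance, c * c', _, scalarMonoid_mul hc hc',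
    (hq.comp (LinearMap.id.prodMap (LinearMap.fst (ZMod p) W W'))).add
      (hq'.comp (LinearMap.id.prodMap (LinearMap.snd (ZMod p) W W'))), fun v => ?_⟩
  simp only [h, h', omegaPow_add, Fintype.sum_prod_type]
  simp only [LinearMap.prodMap_apply, LinearMap.id_apply, LinearMap.fst_apply, LinearMap.snd_apply]
  simp only [← mul_sum, ← sum_mul]
  ring

theorem IsGaussian.sum [Fintype V'] {f : V × V' → ℂ} (hf : IsGaussian p f) :
    IsGaussian p fun v => ∑ w, f (v, w) := by
  obtain ⟨W, _, _, _, c, q, hc, hq, h⟩ := hf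
  refine ⟨V' × W, inferInstance, inferInstance, inferInstance, c, _, hc,
    hq.comp (LinearEquiv.prodAssoc (ZMod p) V V' W).symm.toLinearMap, fun v => ?_⟩
  simp only [h, ← mul_sum, Fintype.sum_prod_type]
  rfl

theorem IsGaussian.omegaPow {q : V → ZMod p} (hq : IsQuadratic q) :
    IsGaussian p fun v => omegaPow p (q v) :=
  ⟨Unit, inferInstance, inferInstance, inferInstance, 1, _, one_mem_scalarMonoid,
    hq.comp (LinearMap.fst (ZMod p) V Unit), fun v => by simp⟩

theorem IsGaussian.const {c : ℂ} (hc : c ∈ scalarMonoid p) : IsGaussian p fun _ : V => c :=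
  ⟨Unit, inferInstance, inferInstance, inferInstance, c, fun _ => 0, hc, IsQuadratic.const 0,
    fun v => by simp [omegaPow_zero]⟩

theorem IsGaussian.prod {ι : Type*} (s : Finset ι) {f : ι → V → ℂ}
    (h : ∀ i, IsGaussian p (f i)) : IsGaussian p fun v => ∏ i ∈ s, f i v := by
  classical
  induction s using Finset.induction_on with
  | empty => simpa using IsGaussian.const one_mem_scalarMonoid
  | insert a s ha ih => simpa only [prod_insert ha] using (h a).mul ih

theorem IsGaussian.ite_eq (l m : V →ₗ[ZMod p] ZMod p) :
    IsGaussian p fun v => if l v = m v then (1 : ℂ) else 0 := by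
  have h : IsGaussian p fun v => (p : ℂ)⁻¹ * ∑ k : ZMod p, QupitZX.omegaPow p (k * (l v - m v)) :=
    (IsGaussian.const (scalarMonoid_inv prime_mem_scalarMonoid)).mul
      (IsGaussian.sum (f := fun v : V × ZMod p => QupitZX.omegaPow p (v.2 * (l v.1 - m v.1)))
      (IsGaussian.omegaPow (IsQuadratic.linear_mul (LinearMap.snd (ZMod p) V (ZMod p))
        ((l - m).comp (LinearMap.fst (ZMod p) V (ZMod p))))))
  have hp0 : (p : ℂ) ≠ 0 := by exact_mod_cast (Fact.out : p.Prime).ne_zero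
  convert h using 2 with v
  rw [sum_omegaPow_mul]
  simp only [sub_eq_zero]
  split_ifs <;> simp [hp0]

theorem IsGaussian.ite_eq_pi {n : ℕ} (g h : V →ₗ[ZMod p] Basis p n) :
    IsGaussian p fun v => if g v = h v then (1 : ℂ) else 0 := by
  have := IsGaussian.prod univ fun i =>
    IsGaussian.ite_eq ((LinearMap.proj i).comp g) ((LinearMap.proj i).comp h)
  convert this using 2 with v
  rw [prod_ite_zero]
  simp [funext_iff]

end Gaussian

section Operators

variable {p : ℕ} [Fact p.Prime]

/-- The operator `∑_y |g(y)⟩⟨y|`. -/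
def funOp {m n : ℕ} (g : Basis p m → Basis p n) : Op p m n :=
  Matrix.of fun x y => if x = g y then 1 else 0

/-- The operator `p^{-1/2} ∑_{x,y} ω^{sxy} |x⟩⟨y|` on one qupit. -/
def fourierOp (s : ZMod p) : Op p 1 1 :=
  Matrix.of fun x y => omegaPow p (s * (x 0 * y 0)) / sqrtP p

theorem funOp_apply {m n : ℕ} (g : Basis p m → Basis p n) (x : Basis p n) (y : Basis p m) :
    funOp g x y = if x = g y then 1 else 0 := rfl

theorem fourierOp_apply (s : ZMod p) (x y : Basis p 1) :
    fourierOp s x y = omegaPow p (s * (x 0 * y 0)) / sqrtP p := rfl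

theorem tensorOp_apply {m n m' n' : ℕ} (A : Op p m n) (B : Op p m' n') (x : Basis p (n + n'))
    (y : Basis p (m + m')) : tensorOp A B x y =
      A (fun i => x (Fin.castAdd n' i)) (fun i => y (Fin.castAdd m' i)) *
        B (fun i => x (Fin.natAdd n i)) (fun i => y (Fin.natAdd m i)) := rfl

theorem mul_funOp_apply {k m n : ℕ} (M : Op p m n) (g : Basis p k → Basis p m) (x : Basis p n)
    (y : Basis p k) : (M * funOp g) x y = M x (g y) := by
  simp [Matrix.mul_apply, funOp_apply]

theorem funOp_transpose_mul_apply {k m n : ℕ} (g : Basis p k → Basis p n) (M : Op p m n)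
    (x : Basis p k) (y : Basis p m) : ((funOp g).transpose * M : Op p m k) x y = M (g x) y := by
  simp [Matrix.mul_apply, funOp_apply]

theorem funOp_mul_funOp {k m n : ℕ} (f : Basis p m → Basis p n) (g : Basis p k → Basis p m) :
    funOp f * funOp g = funOp (f ∘ g) := by
  ext x y
  rw [mul_funOp_apply]
  rfl

theorem funOp_id (n : ℕ) : funOp (id : Basis p n → Basis p n) = 1 := by
  ext x y
  simp [funOp_apply, Matrix.one_apply]

theorem dyad_apply {m n : ℕ} (u : Basis p n → ℂ) (v : Basis p m → ℂ) (x : Basis p n)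
    (y : Basis p m) : dyad u v x y = u x * star (v y) := rfl

theorem ketPow_ketZ (n : ℕ) (k : ZMod p) (x : Basis p n) :
    ketPow n (ketZ p k) x = if x = fun _ => k then 1 else 0 := by
  simp only [ketPow, ketZ, Pi.single_apply, prod_ite_zero, prod_const_one, funext_iff, mem_univ,
    true_implies]

theorem star_ketPow_ketZ (n : ℕ) (k : ZMod p) (x : Basis p n) :
    star (ketPow n (ketZ p k) x) = if x = fun _ => k then 1 else 0 := by
  rw [ketPow_ketZ]
  split_ifs <;> simp

theorem ketX_apply (k m : ZMod p) : ketX p k m = omegaPow p (k * m) / sqrtP p := rfl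

theorem star_sqrtP : star (sqrtP p) = sqrtP p := Complex.conj_ofReal _

theorem ketPow_ketX (n : ℕ) (k : ZMod p) (x : Basis p n) :
    ketPow n (ketX p k) x = omegaPow p (k * ∑ i, x i) / sqrtP p ^ n := by
  simp [ketPow, ketX_apply, prod_div_distrib, mul_sum, omegaPow_sum]

theorem star_ketPow_ketX (n : ℕ) (k : ZMod p) (x : Basis p n) :
    star (ketPow n (ketX p k) x) = omegaPow p (-k * ∑ i, x i) / sqrtP p ^ n := by
  rw [ketPow_ketX, star_div₀, star_pow, star_sqrtP, star_omegaPow, neg_mul]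

theorem dyad_ketZ {m n : ℕ} (k l : ZMod p) (x : Basis p n) (y : Basis p m) :
    dyad (ketPow n (ketZ p k)) (ketPow m (ketZ p l)) x y =
      (if x = fun _ => k then 1 else 0) * if y = fun _ => l then 1 else 0 := by
  rw [dyad_apply, ketPow_ketZ, star_ketPow_ketZ]

theorem dyad_ketX {m n : ℕ} (k l : ZMod p) (x : Basis p n) (y : Basis p m) :
    dyad (ketPow n (ketX p k)) (ketPow m (ketX p l)) x y =
      (omegaPow p (k * ∑ i, x i) / sqrtP p ^ n) * (omegaPow p (-l * ∑ i, y i) / sqrtP p ^ m) := by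
  rw [dyad_apply, ketPow_ketX, star_ketPow_ketX]

theorem greenOp_apply (m n : ℕ) (a b : ZMod p) (x : Basis p n) (y : Basis p m) :
    greenOp m n a b x y = ∑ k, spiderPhase a b k *
      ((if x = fun _ => k then 1 else 0) * if y = fun _ => k then 1 else 0) := by
  simp only [greenOp, Matrix.sum_apply, Matrix.smul_apply, smul_eq_mul, dyad_ketZ]

theorem redOp_apply (m n : ℕ) (a b : ZMod p) (x : Basis p n) (y : Basis p m) :
    redOp m n a b x y = (sqrtP p ^ n)⁻¹ * (sqrtP p ^ m)⁻¹ *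
      ∑ k, spiderPhase a b k * omegaPow p (-k * (∑ i, x i + ∑ i, y i)) := by
  simp only [redOp, Matrix.sum_apply, Matrix.smul_apply, smul_eq_mul, dyad_ketX]
  rw [mul_sum]
  refine sum_congr rfl fun k _ => ?_
  rw [mul_add, omegaPow_add]
  ring

theorem hadamard_eq_fourierOp : ∑ k : ZMod p, dyad (ketPow 1 (ketX p k)) (ketPow 1 (ketZ p k)) =
    (fourierOp 1 : Op p 1 1) := by
  ext x y
  have hy : ∀ k, (y = fun _ => k) ↔ k = y 0 := fun k =>
    ⟨fun h => by rw [h], fun h => by ext i; rw [h, Subsingleton.elim i 0]⟩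
  simp only [Matrix.sum_apply, dyad_apply, ketPow_ketX, star_ketPow_ketZ, hy, fourierOp_apply]
  simp [mul_comm]

theorem swapOp_eq_funOp : swapOp p = funOp fun y => ![y 1, y 0] := by
  ext x y
  have h2 : ∀ (z : Basis p 2) (k l : ZMod p), z = ![k, l] ↔ k = z 0 ∧ l = z 1 := fun z k l => by
    simp [funext_iff, Fin.forall_fin_two, eq_comm]
  have hs : ∀ (z : Basis p 2) (k l : ZMod p), (Pi.single ![k, l] 1 : Basis p 2 → ℂ) z =
      if k = z 0 then if l = z 1 then 1 else 0 else 0 := by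
    intro z k l
    rw [Pi.single_apply, ← ite_and]
    exact if_congr (h2 z k l) rfl rfl
  simp only [swapOp, Matrix.sum_apply, dyad_apply, hs, apply_ite star, star_one,
    star_zero, funOp_apply, h2]
  simp only [mul_ite, mul_one, mul_zero]
  rw [sum_eq_single (y 1)]
  · rw [sum_eq_single (y 0)]
    · simp only [if_true, ite_and]
    · intro l _ hl
      simp [hl]
    · simp
  · intro k _ hk
    simp [hk]
  · simp

variable (p) in
/-- The linear map `y ↦ (y, …, y)`. -/
def diagMap (n : ℕ) : Basis p 1 →ₗ[ZMod p] Basis p n := LinearMap.pi fun _ => LinearMap.proj 0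

theorem basis_one_eq_iff (x : Basis p 1) (k : ZMod p) : (x = fun _ => k) ↔ k = x 0 :=
  ⟨fun h => by rw [h], fun h => by ext i; rw [h, Subsingleton.elim i 0]⟩

theorem spiderPhase_zero (k : ZMod p) : spiderPhase 0 0 k = 1 := by
  simp [spiderPhase, omegaPow_zero]

theorem greenOp_comult_eq (n : ℕ) : greenOp 1 n 0 0 = funOp (diagMap p n) := by
  ext x y
  simp only [greenOp_apply, spiderPhase_zero, basis_one_eq_iff y, funOp_apply]
  simp
  rfl

theorem greenOp_mult_eq (n : ℕ) : greenOp n 1 0 0 = (funOp (diagMap p n)).transpose := by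
  ext x y
  rw [greenOp_apply, sum_eq_single (x 0)]
  · simp only [spiderPhase_zero, basis_one_eq_iff x, funOp_apply, Matrix.transpose_apply]
    simp
    rfl
  · intro k _ hk
    simp [basis_one_eq_iff x, hk]
  · simp

theorem greenOp_id_eq : greenOp 1 1 0 0 = (1 : Op p 1 1) := by
  rw [greenOp_comult_eq, ← funOp_id]
  congr 1
  ext x i
  rw [Subsingleton.elim i 0]
  rfl

theorem greenOp_unit_apply (a b : ZMod p) (x : Basis p 1) (y : Basis p 0) :
    greenOp 0 1 a b x y = spiderPhase a b (x 0) := by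
  have hy : ∀ k, y = fun _ => k := fun k => Subsingleton.elim _ _
  simp only [greenOp_apply, basis_one_eq_iff x, if_pos (hy _)]
  simp

theorem greenOp_counit_apply (a b : ZMod p) (x : Basis p 0) (y : Basis p 1) :
    greenOp 1 0 a b x y = spiderPhase a b (y 0) := by
  have hx : ∀ k, x = fun _ => k := fun k => Subsingleton.elim _ _
  simp only [greenOp_apply, basis_one_eq_iff y, if_pos (hx _)]
  simp

theorem state_eq_funOp :
    (dyad (ketPow 1 (ketZ p 0)) (ketPow 0 (ketZ p 0)) : Op p 0 1) = funOp fun _ => 0 := by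
  ext x y
  rw [dyad_apply, ketPow_ketZ, star_ketPow_ketZ, if_pos (Subsingleton.elim y _), mul_one]
  rfl

theorem effect_eq_funOp_transpose :
    (dyad (ketPow 0 (ketZ p 0)) (ketPow 1 (ketZ p 0)) : Op p 1 0) =
      (funOp fun _ => 0).transpose := by
  ext x y
  rw [dyad_apply, ketPow_ketZ, star_ketPow_ketZ, if_pos (Subsingleton.elim x _), one_mul]
  rfl

theorem sum_basis_one {α : Type*} [AddCommMonoid α] (f : Basis p 1 → α) :
    ∑ x, f x = ∑ k : ZMod p, f fun _ => k :=
  (Equiv.sum_comp (Equiv.funUnique (Fin 1) (ZMod p)).symm f).symm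

theorem sum_basis_add {α : Type*} [AddCommMonoid α] (m n : ℕ) (f : Basis p (m + n) → α) :
    ∑ x, f x = ∑ a : Basis p m, ∑ b : Basis p n, f (Fin.append a b) := by
  rw [← Fintype.sum_prod_type' fun a b => f (Fin.append a b)]
  exact (Equiv.sum_comp (Fin.appendEquiv m n) f).symm

theorem append_castAdd {m n : ℕ} (a : Basis p m) (b : Basis p n) :
    (fun i => Fin.append a b (Fin.castAdd n i)) = a := by ext; simp

theorem append_natAdd {m n : ℕ} (a : Basis p m) (b : Basis p n) :
    (fun i => Fin.append a b (Fin.natAdd m i)) = b := by ext; simp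

theorem append_restrict {m n : ℕ} (x : Basis p (m + n)) :
    Fin.append (fun i => x (Fin.castAdd n i)) (fun i => x (Fin.natAdd m i)) = x :=
  Fin.append_castAdd_natAdd

theorem tensorOp_mul_tensorOp {k m n k' m' n' : ℕ} (A : Op p m n) (B : Op p m' n') (C : Op p k m)
    (D : Op p k' m') : tensorOp A B * tensorOp C D = tensorOp (A * C) (B * D) := by
  ext x y
  simp only [Matrix.mul_apply, tensorOp_apply, sum_basis_add, append_castAdd, append_natAdd,
    sum_mul_sum]
  exact sum_congr rfl fun a _ => sum_congr rfl fun b _ => by ring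

theorem tensorOp_conjTranspose {m n m' n' : ℕ} (A : Op p m n) (B : Op p m' n') :
    (tensorOp A B).conjTranspose = tensorOp A.conjTranspose B.conjTranspose := by
  ext x y
  simp [tensorOp_apply, Matrix.conjTranspose_apply]

theorem tensorOp_one_one (m n : ℕ) : tensorOp (1 : Op p m m) (1 : Op p n n) = 1 := by
  ext x y
  simp only [tensorOp_apply, Matrix.one_apply, ← ite_and, mul_ite, mul_one, mul_zero]
  refine if_congr ⟨fun h => ?_, fun h => by simp [h]⟩ rfl rfl
  rw [← append_restrict x, ← append_restrict y, h.1, h.2]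

theorem tensorOp_scalarOp {m n : ℕ} (A : Op p m n) (z : ℂ) :
    (tensorOp A (scalarOp z) : Op p m n) = z • A := by
  ext x y
  exact mul_comm _ _

theorem tensorOp_smul_smul {m n m' n' : ℕ} (a b : ℂ) (A : Op p m n) (B : Op p m' n') :
    tensorOp (a • A) (b • B) = (a * b) • tensorOp A B := by
  ext x y
  simp only [tensorOp_apply, Matrix.smul_apply, smul_eq_mul]
  ring

end Operators

section GaussianOperators

variable {p : ℕ} [Fact p.Prime]

/-- The operators whose amplitudes are quadratic exponential sums in the basis labels. -/
def IsGaussianOp {m n : ℕ} (M : Op p m n) : Prop :=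
  IsGaussian p fun v : Basis p n × Basis p m => M v.1 v.2

theorem IsGaussianOp.comp {k m n : ℕ} {A : Op p m n} {B : Op p k m} (hA : IsGaussianOp A)
    (hB : IsGaussianOp B) : IsGaussianOp (A * B) := by
  have h1 := IsGaussian.comp hA (V' := (Basis p n × Basis p k) × Basis p m)
    (((LinearMap.fst _ _ _).comp (LinearMap.fst _ _ _)).prod (LinearMap.snd _ _ _))
  have h2 := IsGaussian.comp hB (V' := (Basis p n × Basis p k) × Basis p m)
    ((LinearMap.snd _ _ _).prod ((LinearMap.snd _ _ _).comp (LinearMap.fst _ _ _)))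
  exact (h1.mul h2).sum

theorem IsGaussianOp.tensor {m n m' n' : ℕ} {A : Op p m n} {B : Op p m' n'} (hA : IsGaussianOp A)
    (hB : IsGaussianOp B) : IsGaussianOp (tensorOp A B) :=
  (IsGaussian.comp hA ((LinearMap.funLeft (ZMod p) (ZMod p) (Fin.castAdd n')).prodMap
    (LinearMap.funLeft (ZMod p) (ZMod p) (Fin.castAdd m')))).mul
  (IsGaussian.comp hB ((LinearMap.funLeft (ZMod p) (ZMod p) (Fin.natAdd n)).prodMap
    (LinearMap.funLeft (ZMod p) (ZMod p) (Fin.natAdd m))))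

theorem isGaussianOp_funOp {m n : ℕ} (g : Basis p m →ₗ[ZMod p] Basis p n) :
    IsGaussianOp (funOp g) :=
  IsGaussian.ite_eq_pi (LinearMap.fst (ZMod p) (Basis p n) (Basis p m))
    (g.comp (LinearMap.snd (ZMod p) (Basis p n) (Basis p m)))

theorem isQuadratic_spider (a b : ZMod p) :
    IsQuadratic fun k : ZMod p => 2⁻¹ * (a * k + b * k ^ 2) := by
  have := (((IsQuadratic.linear LinearMap.id).smul a).add
    ((IsQuadratic.linear_mul LinearMap.id LinearMap.id).smul b)).smul (2⁻¹ : ZMod p)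
  simpa [pow_two] using this

theorem isGaussianOp_greenOp (m n : ℕ) (a b : ZMod p) : IsGaussianOp (greenOp m n a b) := by
  let E := (Basis p n × Basis p m) × ZMod p
  let z : E →ₗ[ZMod p] ZMod p := LinearMap.snd _ _ _
  have h1 := IsGaussian.omegaPow ((isQuadratic_spider a b).comp z)
  have h2 := IsGaussian.ite_eq_pi ((LinearMap.fst (ZMod p) (Basis p n) (Basis p m)).comp
    (LinearMap.fst (ZMod p) _ (ZMod p))) (LinearMap.pi fun _ => z)
  have h3 := IsGaussian.ite_eq_pi ((LinearMap.snd (ZMod p) (Basis p n) (Basis p m)).comp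
    (LinearMap.fst (ZMod p) _ (ZMod p))) (LinearMap.pi fun _ => z)
  have := (h1.mul (h2.mul h3)).sum
  unfold IsGaussianOp
  simp only [greenOp_apply]
  exact this

theorem isGaussianOp_redOp (m n : ℕ) (a b : ZMod p) : IsGaussianOp (redOp m n a b) := by
  let E := (Basis p n × Basis p m) × ZMod p
  let z : E →ₗ[ZMod p] ZMod p := LinearMap.snd _ _ _
  have h1 := IsGaussian.omegaPow ((isQuadratic_spider a b).comp z)
  let s : ∀ k, Basis p k →ₗ[ZMod p] ZMod p := fun k => ∑ i, LinearMap.proj i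
  let l : E →ₗ[ZMod p] ZMod p :=
    ((s n).comp (LinearMap.fst (ZMod p) (Basis p n) (Basis p m)) +
      (s m).comp (LinearMap.snd (ZMod p) (Basis p n) (Basis p m))).comp
        (LinearMap.fst (ZMod p) _ (ZMod p))
  have h2 := IsGaussian.omegaPow (IsQuadratic.linear_mul (-z) l)
  have hc : ∀ k, (sqrtP p ^ k)⁻¹ ∈ scalarMonoid p := fun k =>
    scalarMonoid_inv (scalarMonoid_pow sqrtP_mem_scalarMonoid k)
  have := (IsGaussian.const (V := Basis p n × Basis p m)
    (scalarMonoid_mul (hc n) (hc m))).mul (h1.mul h2).sum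
  unfold IsGaussianOp
  simp only [redOp_apply]
  convert this using 5 with v w
  · rfl
  · have hl : l (v, w) = ∑ i, v.1 i + ∑ i, v.2 i := by
      simp [l, s]
      rfl
    rw [hl]
    rfl

theorem isGaussianOp_fourierOp (s : ZMod p) : IsGaussianOp (fourierOp s) := by
  have h := (IsQuadratic.linear_mul (V := Basis p 1 × Basis p 1)
    ((LinearMap.proj 0).comp (LinearMap.fst (ZMod p) _ _))
    ((LinearMap.proj 0).comp (LinearMap.snd (ZMod p) _ _))).smul s
  exact (IsGaussian.omegaPow h).mul (IsGaussian.const (scalarMonoid_inv sqrtP_mem_scalarMonoid))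

theorem isGaussianOp_interp {m n : ℕ} (D : Diagram p m n) : IsGaussianOp (interp D) := by
  induction D with
  | id n =>
    rw [interp, ← funOp_id]
    exact isGaussianOp_funOp LinearMap.id
  | braid =>
    have := isGaussianOp_funOp (LinearMap.funLeft (ZMod p) (ZMod p) (![1, 0] : Fin 2 → Fin 2))
    rw [interp, swapOp_eq_funOp]
    convert this using 2
    ext y i
    fin_cases i <;> rfl
  | hadamard => simpa only [interp, hadamard_eq_fourierOp] using isGaussianOp_fourierOp 1
  | star => exact IsGaussian.const neg_one_mem_scalarMonoid
  | comp D E hD hE => exact hE.comp hD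
  | tensor D E hD hE => exact hD.tensor hE
  | antipode | redUnit | redCounit | redMult | redComult => exact isGaussianOp_redOp _ _ _ _
  | _ => exact isGaussianOp_greenOp _ _ _ _

end GaussianOperators

section Clifford

variable {p : ℕ} [Fact p.Prime]

theorem mul_pauli_apply {m n : ℕ} (U : Op p m n) (k : ZMod p) (a b : Basis p m) (x : Basis p n)
    (y : Basis p m) : (U * pauli k a b) x y = U x (y + a) * omegaPow p (k + b ⬝ᵥ y) := by
  simp [Matrix.mul_apply, pauli]

theorem pauli_mul_apply {m n : ℕ} (U : Op p m n) (k : ZMod p) (a b : Basis p n) (x : Basis p n)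
    (y : Basis p m) :
    (pauli k a b * U) x y = omegaPow p (k + b ⬝ᵥ (x - a)) * U (x - a) y := by
  simp only [Matrix.mul_apply, pauli, Matrix.of_apply, ← sub_eq_iff_eq_add, ite_mul, zero_mul]
  simp

theorem isClifford_of_intertwines {n : ℕ} {U : Op p n n} (hU : U * U.conjTranspose = 1)
    (h : ∀ k a b, ∃ k' a' b', ∀ x y, U x (y + a) * omegaPow p (k + b ⬝ᵥ y) =
      omegaPow p (k' + b' ⬝ᵥ (x - a')) * U (x - a') y) : IsClifford U := by
  refine ⟨Matrix.mem_unitaryGroup_iff.2 hU, ?_⟩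
  rintro _ ⟨k, a, b, rfl⟩
  obtain ⟨k', a', b', h'⟩ := h k a b
  refine ⟨k', a', b', ?_⟩
  have : U * pauli k a b = pauli k' a' b' * U := by
    ext x y
    rw [mul_pauli_apply, pauli_mul_apply, h']
  rw [this, Matrix.mul_assoc, hU, Matrix.mul_one]

theorem exists_dotProduct_eq {n : ℕ} (l : Basis p n →ₗ[ZMod p] ZMod p) :
    ∃ b : Basis p n, ∀ y, b ⬝ᵥ y = l y := by
  obtain ⟨b, hb⟩ := (dotProductEquiv (ZMod p) (Fin n)).surjective l
  exact ⟨b, fun y => by rw [← hb]; rfl⟩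

theorem fourierOp_conjTranspose (s : ZMod p) :
    (fourierOp s).conjTranspose = fourierOp (-s) := by
  ext x y
  rw [Matrix.conjTranspose_apply, fourierOp_apply, fourierOp_apply, star_div₀, star_omegaPow,
    star_sqrtP]
  congr 2
  ring

theorem fourierOp_mul_neg {s : ZMod p} (hs : s ≠ 0) : fourierOp s * fourierOp (-s) = 1 := by
  ext x y
  have h : ∀ k, fourierOp s x (fun _ => k) * fourierOp (-s) (fun _ => k) y =
      (p : ℂ)⁻¹ * omegaPow p (k * (s * (x 0 - y 0))) := by
    intro k
    rw [fourierOp_apply, fourierOp_apply, div_mul_div_comm, ← omegaPow_add, sqrtP_mul_self,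
      div_eq_inv_mul]
    congr 2
    ring
  rw [Matrix.mul_apply, sum_basis_one]
  simp only [h]
  rw [← mul_sum, sum_omegaPow_mul, Matrix.one_apply]
  have hp0 : (p : ℂ) ≠ 0 := by exact_mod_cast (Fact.out : p.Prime).ne_zero
  have hxy : s * (x 0 - y 0) = 0 ↔ x = y := by
    rw [mul_eq_zero, or_iff_right hs, sub_eq_zero]
    exact ⟨fun h => by ext i; rwa [Subsingleton.elim i 0], fun h => by rw [h]⟩
  simp only [hxy]
  split_ifs <;> simp [hp0]

theorem isClifford_fourierOp {s : ZMod p} (hs : s ≠ 0) : IsClifford (fourierOp s) := by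
  refine isClifford_of_intertwines
    (by rw [fourierOp_conjTranspose, fourierOp_mul_neg hs]) fun k a b => ?_
  refine ⟨k - a 0 * b 0, fun _ => -b 0 / s, fun _ => s * a 0, fun x y => ?_⟩
  rw [fourierOp_apply, fourierOp_apply, div_mul_eq_mul_div, ← mul_div_assoc, ← omegaPow_add,
    ← omegaPow_add]
  congr 2
  simp only [dotProduct, Fin.sum_univ_one, Pi.sub_apply, Pi.add_apply]
  field_simp
  ring

/-- The diagonal operator with entries `ω^{q(x)}`. -/
def phaseOp {n : ℕ} (q : Basis p n → ZMod p) : Op p n n :=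
  Matrix.diagonal fun x => omegaPow p (q x)

theorem phaseOp_conjTranspose {n : ℕ} (q : Basis p n → ZMod p) :
    (phaseOp q).conjTranspose = phaseOp fun x => -q x := by
  rw [phaseOp, Matrix.diagonal_conjTranspose, phaseOp]
  congr 1
  ext x
  exact star_omegaPow _

theorem phaseOp_mul_phaseOp {n : ℕ} (q r : Basis p n → ZMod p) :
    phaseOp q * phaseOp r = phaseOp fun x => q x + r x := by
  simp only [phaseOp, Matrix.diagonal_mul_diagonal, omegaPow_add]

theorem phaseOp_zero (n : ℕ) : phaseOp (fun _ : Basis p n => 0) = 1 := by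
  simp [phaseOp, omegaPow_zero]

theorem isClifford_phaseOp {n : ℕ} {q : Basis p n → ZMod p} (hq : IsQuadratic q) :
    IsClifford (phaseOp q) := by
  refine isClifford_of_intertwines ?_ fun k a b => ?_
  · rw [phaseOp_conjTranspose, phaseOp_mul_phaseOp]
    simp [phaseOp_zero]
  obtain ⟨Q, l, c, hq⟩ := hq
  obtain ⟨b', hb'⟩ := exists_dotProduct_eq (Q.polarBilin a + dotProductEquiv _ _ b)
  refine ⟨k + Q a + l a, a, b', fun x y => ?_⟩
  simp only [phaseOp, Matrix.diagonal_apply, sub_eq_iff_eq_add, ite_mul, mul_ite, zero_mul,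
    mul_zero]
  refine if_ctx_congr Iff.rfl (fun hx => ?_) fun _ => rfl
  rw [← omegaPow_add, ← omegaPow_add, hb', hx]
  congr 1
  simp only [hq, add_sub_cancel_right, LinearMap.add_apply, QuadraticMap.polarBilin_apply_apply,
    QuadraticMap.polar, dotProductEquiv_apply_apply, map_add, add_comm a y]
  ring

theorem funOp_conjTranspose {m n : ℕ} (g : Basis p m → Basis p n) :
    (funOp g).conjTranspose = (funOp g).transpose := by
  ext x y
  simp [funOp_apply, Matrix.conjTranspose_apply, apply_ite star]

theorem funOp_equiv_transpose {n : ℕ} (e : Basis p n ≃ₗ[ZMod p] Basis p n) :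
    (funOp e).transpose = funOp e.symm := by
  ext x y
  rw [Matrix.transpose_apply, funOp_apply, funOp_apply]
  exact if_congr (by rw [e.eq_symm_apply, eq_comm]) rfl rfl

theorem isClifford_funOp {n : ℕ} (e : Basis p n ≃ₗ[ZMod p] Basis p n) :
    IsClifford (funOp e) := by
  refine isClifford_of_intertwines ?_ fun k a b => ?_
  · rw [funOp_conjTranspose, funOp_equiv_transpose, funOp_mul_funOp, ← funOp_id]
    congr 1
    ext x
    simp
  obtain ⟨b', hb'⟩ := exists_dotProduct_eq
    ((dotProductEquiv (ZMod p) (Fin n) b).comp e.symm.toLinearMap)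
  refine ⟨k, e a, b', fun x y => ?_⟩
  simp only [funOp_apply, sub_eq_iff_eq_add, ite_mul, mul_ite, zero_mul, mul_zero, one_mul,
    mul_one, ← map_add]
  refine if_ctx_congr Iff.rfl (fun hx => ?_) fun _ => rfl
  rw [hb', hx, ← map_sub]
  simp

theorem tensorOp_pauli {m n : ℕ} (k l : ZMod p) (a b : Basis p m) (c d : Basis p n) :
    tensorOp (pauli k a b) (pauli l c d) = pauli (k + l) (Fin.append a c) (Fin.append b d) := by
  ext x y
  have hx : x = y + Fin.append a c ↔
      ((fun i => x (Fin.castAdd n i)) = (fun i => y (Fin.castAdd n i)) + a) ∧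
        ((fun i => x (Fin.natAdd m i)) = (fun i => y (Fin.natAdd m i)) + c) := by
    simp [funext_iff, Fin.forall_fin_add]
  simp only [tensorOp_apply, pauli, Matrix.of_apply, hx, ite_and, ite_mul, mul_ite, zero_mul,
    mul_zero, ← omegaPow_add]
  have hd : Fin.append b d ⬝ᵥ y =
      b ⬝ᵥ (fun i => y (Fin.castAdd n i)) + d ⬝ᵥ (fun i => y (Fin.natAdd m i)) := by
    simp [dotProduct, Fin.sum_univ_add]
  rw [hd, add_add_add_comm]
  split_ifs <;> rfl

theorem IsClifford.tensor {m n : ℕ} {U : Op p m m} {V : Op p n n} (hU : IsClifford U)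
    (hV : IsClifford V) : IsClifford (tensorOp U V) := by
  refine ⟨?_, ?_⟩
  · have h1 := Matrix.mem_unitaryGroup_iff.1 hU.1
    have h2 := Matrix.mem_unitaryGroup_iff.1 hV.1
    rw [Matrix.star_eq_conjTranspose] at h1 h2
    rw [Matrix.mem_unitaryGroup_iff, Matrix.star_eq_conjTranspose, tensorOp_conjTranspose,
      tensorOp_mul_tensorOp, h1, h2, tensorOp_one_one]
  · rintro _ ⟨k, a, b, rfl⟩
    have : pauli k a b = tensorOp (pauli k (fun i => a (Fin.castAdd n i))
        (fun i => b (Fin.castAdd n i))) (pauli 0 (fun i => a (Fin.natAdd m i))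
        (fun i => b (Fin.natAdd m i))) := by
      rw [tensorOp_pauli, append_restrict, append_restrict, add_zero]
    rw [this, tensorOp_conjTranspose, tensorOp_mul_tensorOp, tensorOp_mul_tensorOp]
    obtain ⟨k₁, a₁, b₁, h₁⟩ := hU.2 _ ⟨k, fun i => a (Fin.castAdd n i),
      fun i => b (Fin.castAdd n i), rfl⟩
    obtain ⟨k₂, a₂, b₂, h₂⟩ := hV.2 _ ⟨0, fun i => a (Fin.natAdd m i),
      fun i => b (Fin.natAdd m i), rfl⟩
    exact ⟨_, _, _, by rw [h₁, h₂, tensorOp_pauli]⟩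

theorem det_tensorOp {m n : ℕ} (U : Op p m m) (V : Op p n n) :
    (tensorOp U V).det =
      U.det ^ Fintype.card (Basis p n) * V.det ^ Fintype.card (Basis p m) := by
  rw [← Matrix.det_kronecker, ← Matrix.det_submatrix_equiv_self (Fin.appendEquiv m n).symm]
  rfl

theorem tensorOp_conjTranspose_mem_reducedClifford {n : ℕ} {U : Op p n n} (hU : IsClifford U)
    (hU' : IsClifford U.conjTranspose) :
    tensorOp U U.conjTranspose ∈ reducedClifford p (n + n) := by
  refine ⟨1, one_mem_phaseGroup, _, hU.tensor hU', ?_, (one_smul _ _).symm⟩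
  have h1 := Matrix.mem_unitaryGroup_iff.1 hU.1
  rw [Matrix.star_eq_conjTranspose] at h1
  rw [det_tensorOp, ← mul_pow, ← Matrix.det_mul, h1, Matrix.det_one, one_pow]

end Clifford

section Generated

variable {p : ℕ} [Fact p.Prime]

theorem Generated.smul {m n : ℕ} {M : Op p m n} (hM : Generated M) {z : ℂ}
    (hz : z ∈ scalarMonoid p) : Generated (z • M) := by
  rw [← tensorOp_scalarOp]
  exact Generated.tensor _ _ hM (Generated.scalar z hz)

theorem generated_zero_state (n : ℕ) :
    Generated (funOp fun _ => 0 : Op p 0 n) ∧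
      Generated ((funOp fun _ => 0 : Op p 0 n).transpose) := by
  induction n with
  | zero =>
    have : (funOp fun _ => 0 : Op p 0 0) = 1 := by
      rw [← funOp_id]
      congr 1
      ext x i
      exact i.elim0
    rw [this, Matrix.transpose_one]
    exact ⟨Generated.id 0, Generated.id 0⟩
  | succ n ih =>
    have h : (funOp fun _ => 0 : Op p 0 (n + 1)) =
        tensorOp (funOp fun _ => 0 : Op p 0 n) (funOp fun _ => 0 : Op p 0 1) := by
      ext x y
      simp only [tensorOp_apply, funOp_apply, ← ite_and, mul_ite, mul_one, mul_zero]
      refine if_congr ⟨fun h => by subst h; exact ⟨rfl, rfl⟩, fun h => ?_⟩ rfl rfl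
      rw [← append_restrict x, h.1, h.2]
      ext i
      refine Fin.addCases (fun i => ?_) (fun i => ?_) i <;> simp
    have h' : (funOp fun _ => 0 : Op p 0 (n + 1)).transpose =
        tensorOp (funOp fun _ => 0 : Op p 0 n).transpose
          (funOp fun _ => 0 : Op p 0 1).transpose := by
      rw [h]
      rfl
    rw [h', h]
    have hs := Generated.state (p := p)
    have he := Generated.effect (p := p)
    rw [state_eq_funOp] at hs
    rw [effect_eq_funOp_transpose] at he
    exact ⟨Generated.tensor _ _ ih.1 hs, Generated.tensor _ _ ih.2 he⟩

theorem generated_of_isClifford {n : ℕ} {U : Op p n n} (hU : IsClifford U)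
    (hU' : IsClifford U.conjTranspose) (h0 : U 0 0 ≠ 0)
    (hs : star (U 0 0) ∈ scalarMonoid p) : Generated U := by
  have hT := Generated.clifford _ (tensorOp_conjTranspose_mem_reducedClifford hU hU')
  obtain ⟨hK, hK'⟩ := generated_zero_state (p := p) n
  have h1 := Generated.tensor _ _ (Generated.id n) hK
  have h2 := Generated.tensor _ _ (Generated.id n) hK'
  have h3 := Generated.comp _ _ (Generated.comp _ _ h1 hT) h2
  rw [tensorOp_mul_tensorOp, tensorOp_mul_tensorOp, Matrix.mul_one, Matrix.one_mul] at h3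
  have : (((funOp fun _ => 0 : Op p 0 n).transpose : Op p n 0) *
      ((U.conjTranspose : Op p n n) * (funOp fun _ => 0 : Op p 0 n)) : Op p 0 0) =
        scalarOp (star (U 0 0)) := by
    ext x y
    rw [funOp_transpose_mul_apply, mul_funOp_apply]
    rfl
  rw [this, tensorOp_scalarOp] at h3
  have h4 := h3.smul (scalarMonoid_inv hs)
  rwa [smul_smul, inv_mul_cancel₀ (star_ne_zero.2 h0), one_smul] at h4

theorem generated_fourierOp {s : ZMod p} (hs : s ≠ 0) : Generated (fourierOp s) := by
  have h0 : fourierOp s 0 0 = (sqrtP p)⁻¹ := by simp [fourierOp_apply, omegaPow_zero]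
  refine generated_of_isClifford (isClifford_fourierOp hs) ?_ ?_ ?_
  · rw [fourierOp_conjTranspose]
    exact isClifford_fourierOp (neg_ne_zero.2 hs)
  · rw [h0]
    exact inv_ne_zero sqrtP_ne_zero
  · rw [h0, star_inv₀, star_sqrtP]
    exact scalarMonoid_inv sqrtP_mem_scalarMonoid

theorem generated_phaseOp {n : ℕ} {q : Basis p n → ZMod p} (hq : IsQuadratic q) :
    Generated (phaseOp q) := by
  have h0 : phaseOp q 0 0 = omegaPow p (q 0) := by simp [phaseOp]
  refine generated_of_isClifford (isClifford_phaseOp hq) ?_ ?_ ?_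
  · rw [phaseOp_conjTranspose]
    exact isClifford_phaseOp hq.neg
  · rw [h0]
    exact omegaPow_ne_zero _
  · rw [h0, star_omegaPow]
    exact omegaPow_mem_scalarMonoid _

theorem generated_funOp {n : ℕ} (e : Basis p n ≃ₗ[ZMod p] Basis p n) : Generated (funOp e) := by
  have h0 : funOp e 0 0 = 1 := by simp [funOp_apply]
  refine generated_of_isClifford (isClifford_funOp e) ?_ ?_ ?_
  · rw [funOp_conjTranspose, funOp_equiv_transpose]
    exact isClifford_funOp e.symm
  · rw [h0]
    exact one_ne_zero
  · rw [h0, star_one]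
    exact one_mem_scalarMonoid

variable (p) in
/-- The controlled addition `(y₀, y₁) ↦ (y₀, y₀ + y₁)`. -/
def controlledAdd : Basis p 2 ≃ₗ[ZMod p] Basis p 2 where
  toFun y := ![y 0, y 0 + y 1]
  invFun y := ![y 0, y 1 - y 0]
  map_add' x y := by
    ext i
    fin_cases i
    · rfl
    · simp
      ring
  map_smul' c x := by
    ext i
    fin_cases i
    · rfl
    · simp
      ring
  left_inv y := by
    ext i
    fin_cases i
    · rfl
    · simp
  right_inv y := by
    ext i
    fin_cases i
    · rfl
    · simp

theorem generated_greenOp_comult : Generated (greenOp 1 2 0 0 : Op p 1 2) := by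
  have h := Generated.comp _ _
    (Generated.tensor _ _ (Generated.id 1) (generated_zero_state (p := p) 1).1)
    (generated_funOp (controlledAdd p))
  have h1 : (tensorOp (1 : Op p 1 1) (funOp fun _ => 0 : Op p 0 1) : Op p 1 2) =
      funOp fun y => ![y 0, 0] := by
    ext x y
    simp only [tensorOp_apply, funOp_apply, Matrix.one_apply, ← ite_and, mul_ite, mul_one,
      mul_zero]
    refine if_congr ?_ rfl rfl
    simp only [funext_iff, Fin.forall_fin_one]
    refine ⟨fun h i => ?_, fun h => ⟨h 1, h 0⟩⟩
    fin_cases i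
    exacts [h.2, h.1]
  have h2 : funOp (controlledAdd p) *
      (tensorOp (1 : Op p 1 1) (funOp fun _ => 0 : Op p 0 1) : Op p 1 2) = greenOp 1 2 0 0 := by
    rw [h1, funOp_mul_funOp, greenOp_comult_eq]
    congr 1
    ext y i
    fin_cases i
    · rfl
    · exact add_zero _
  rw [← h2]
  exact h

theorem generated_greenOp_mult : Generated (greenOp 2 1 0 0 : Op p 2 1) := by
  have h := Generated.comp _ _ (generated_funOp (controlledAdd p).symm)
    (Generated.tensor _ _ (Generated.id 1) (generated_zero_state (p := p) 1).2)
  have h2 : (tensorOp (1 : Op p 1 1) (funOp fun _ => 0 : Op p 0 1).transpose : Op p 2 1) *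
      funOp (controlledAdd p).symm = greenOp 2 1 0 0 := by
    ext x y
    rw [mul_funOp_apply, greenOp_mult_eq, Matrix.transpose_apply]
    simp only [tensorOp_apply, funOp_apply, Matrix.one_apply, Matrix.transpose_apply, ← ite_and,
      mul_ite, mul_one, mul_zero]
    refine if_congr ?_ rfl rfl
    simp only [funext_iff, Fin.forall_fin_one, Fin.forall_fin_two]
    constructor
    · rintro ⟨h1, h2⟩
      have h1' : y 1 - y 0 = 0 := h1
      have h2' : x 0 = y 0 := h2
      exact ⟨h2'.symm, (sub_eq_zero.1 h1').trans h2'.symm⟩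
    · rintro ⟨h1, h2⟩
      have h1' : y 0 = x 0 := h1
      have h2' : y 1 = x 0 := h2
      exact ⟨sub_eq_zero.2 (h2'.trans h1'.symm), h1'.symm⟩
  rw [← h2]
  exact h

theorem isQuadratic_spider_basis (a b : ZMod p) :
    IsQuadratic fun y : Basis p 1 => 2⁻¹ * (a * y 0 + b * y 0 ^ 2) :=
  (isQuadratic_spider a b).comp (LinearMap.proj 0 : Basis p 1 →ₗ[ZMod p] ZMod p)

theorem generated_greenOp_unit (a b : ZMod p) : Generated (greenOp 0 1 a b : Op p 0 1) := by
  have h := (Generated.comp _ _ (Generated.comp _ _ (generated_zero_state (p := p) 1).1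
    (generated_fourierOp one_ne_zero)) (generated_phaseOp (isQuadratic_spider_basis a b))).smul
      sqrtP_mem_scalarMonoid
  convert h using 1
  ext x y
  rw [greenOp_unit_apply, Matrix.smul_apply, smul_eq_mul, phaseOp, Matrix.diagonal_mul,
    mul_funOp_apply, fourierOp_apply]
  simp only [Pi.zero_apply, mul_zero, omegaPow_zero]
  rw [spiderPhase]
  field_simp [sqrtP_ne_zero]

theorem generated_greenOp_counit (a b : ZMod p) : Generated (greenOp 1 0 a b : Op p 1 0) := by
  have h := (Generated.comp _ _ (Generated.comp _ _
    (generated_phaseOp (isQuadratic_spider_basis a b)) (generated_fourierOp one_ne_zero))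
      (generated_zero_state (p := p) 1).2).smul sqrtP_mem_scalarMonoid
  convert h using 1
  ext x y
  rw [greenOp_counit_apply, Matrix.smul_apply, smul_eq_mul, phaseOp, funOp_transpose_mul_apply,
    Matrix.mul_diagonal, fourierOp_apply]
  simp only [Pi.zero_apply, mul_zero, zero_mul, omegaPow_zero]
  rw [spiderPhase]
  field_simp [sqrtP_ne_zero]

theorem generated_greenOp_cup : Generated (greenOp 0 2 0 0 : Op p 0 2) := by
  have h := Generated.comp _ _ (generated_greenOp_unit (p := p) 0 0) generated_greenOp_comult
  convert h using 1
  ext x y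
  have hy : ∀ k, y = fun _ => k := fun k => Subsingleton.elim _ _
  rw [Matrix.mul_apply, sum_basis_one, greenOp_apply]
  simp only [greenOp_comult_eq, greenOp_unit_apply, spiderPhase_zero, funOp_apply, if_pos (hy _)]
  simp
  rfl

theorem generated_greenOp_cap : Generated (greenOp 2 0 0 0 : Op p 2 0) := by
  have h := Generated.comp _ _ generated_greenOp_mult (generated_greenOp_counit (p := p) 0 0)
  convert h using 1
  ext x y
  have hx : ∀ k, x = fun _ => k := fun k => Subsingleton.elim _ _
  rw [Matrix.mul_apply, sum_basis_one, greenOp_apply]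
  simp only [greenOp_mult_eq, greenOp_counit_apply, spiderPhase_zero, funOp_apply,
    Matrix.transpose_apply, if_pos (hx _)]
  simp
  rfl

/-- The tensor power `(p^{-1/2} ∑_{x,y} ω^{sxy} |x⟩⟨y|)^{⊗n}`. -/
def fourierPow (n : ℕ) (s : ZMod p) : Op p n n :=
  Matrix.of fun x y => omegaPow p (s * ∑ i, x i * y i) / sqrtP p ^ n

theorem generated_fourierPow (n : ℕ) {s : ZMod p} (hs : s ≠ 0) :
    Generated (fourierPow n s) := by
  induction n with
  | zero =>
    have : (fourierPow 0 s) = 1 := by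
      ext x y
      simp [fourierPow, omegaPow_zero, Matrix.one_apply, Subsingleton.elim x y]
    rw [this]
    exact Generated.id 0
  | succ n ih =>
    have : fourierPow (n + 1) s = tensorOp (fourierPow n s) (fourierOp s) := by
      ext x y
      simp only [fourierPow, tensorOp_apply, Matrix.of_apply, fourierOp_apply, Fin.sum_univ_add,
        Fin.sum_univ_one, mul_add, omegaPow_add, pow_succ]
      rw [div_mul_div_comm]
    rw [this]
    exact Generated.tensor _ _ ih (generated_fourierOp hs)

theorem redOp_eq_fourier_greenOp (m n : ℕ) (a b : ZMod p) :
    (redOp m n a b : Op p m n) =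
      (fourierPow n (-1) : Op p n n) *
        ((greenOp m n a b : Op p m n) * (fourierPow m (-1) : Op p m m)) := by
  have hket : ∀ k : ZMod p, (fourierPow n (-1)).mulVec (ketPow n (ketZ p k)) =
      ketPow n (ketX p (-k)) := by
    intro k
    ext x
    rw [ketPow_ketX]
    simp only [Matrix.mulVec, dotProduct, ketPow_ketZ, fourierPow, Matrix.of_apply, mul_ite,
      mul_one, mul_zero, sum_ite_eq', mem_univ, if_true]
    rw [← sum_mul]
    congr 2
    ring
  have hbra : ∀ k : ZMod p, Matrix.vecMul (star (ketPow m (ketZ p k))) (fourierPow m (-1)) =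
      star (ketPow m (ketX p k)) := by
    intro k
    ext y
    rw [Pi.star_apply, star_ketPow_ketX]
    simp only [Matrix.vecMul, dotProduct, Pi.star_apply]
    rw [sum_eq_single fun _ => k]
    · rw [star_ketPow_ketZ, if_pos rfl, one_mul]
      simp only [fourierPow, Matrix.of_apply]
      rw [← mul_sum]
      congr 2
      ring
    · intro z _ hz
      rw [star_ketPow_ketZ, if_neg hz, zero_mul]
    · simp
  simp only [redOp, greenOp, Matrix.mul_sum, Matrix.sum_mul, Matrix.mul_smul, Matrix.smul_mul,
    dyad, Matrix.mul_vecMulVec, Matrix.vecMulVec_mul, hket, hbra]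

theorem generated_redOp {m n : ℕ} {a b : ZMod p} (h : Generated (greenOp m n a b : Op p m n)) :
    Generated (redOp m n a b : Op p m n) := by
  have h1 : (-1 : ZMod p) ≠ 0 := neg_ne_zero.2 one_ne_zero
  rw [redOp_eq_fourier_greenOp]
  exact Generated.comp _ _ (Generated.comp _ _ (generated_fourierPow m h1) h)
    (generated_fourierPow n h1)

theorem generated_interp {m n : ℕ} (D : Diagram p m n) : Generated (interp D) := by
  have hid : Generated (greenOp 1 1 0 0 : Op p 1 1) := by
    rw [greenOp_id_eq]
    exact Generated.id 1
  induction D with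
  | id n => exact Generated.id n
  | braid => exact Generated.swap
  | cup => exact generated_greenOp_cup
  | cap => exact generated_greenOp_cap
  | hadamard =>
    rw [interp, hadamard_eq_fourierOp]
    exact generated_fourierOp one_ne_zero
  | star => exact Generated.scalar _ neg_one_mem_scalarMonoid
  | greenId => exact hid
  | greenUnit a b => exact generated_greenOp_unit a b
  | greenCounit a b => exact generated_greenOp_counit a b
  | greenMult => exact generated_greenOp_mult
  | greenComult => exact generated_greenOp_comult
  | antipode => exact generated_redOp hid
  | redUnit a b => exact generated_redOp (generated_greenOp_unit a b)
  | redCounit a b => exact generated_redOp (generated_greenOp_counit a b)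
  | redMult => exact generated_redOp generated_greenOp_mult
  | redComult => exact generated_redOp generated_greenOp_comult
  | comp D E hD hE => exact Generated.comp _ _ hD hE
  | tensor D E hD hE => exact Generated.tensor _ _ hD hE

theorem isStabiliserOperation_interp (hp : p ≠ 2) {m n : ℕ} (D : Diagram p m n) :
    IsStabiliserOperation (interp D) :=
  ⟨generated_interp D, fun x y => (isGaussianOp_interp D).mem_scalarMonoid hp (x, y)⟩

end Generated

section ScaledDiagrams

variable {p : ℕ} [Fact p.Prime]

/-- The operators that are scalar multiples of interpretations of diagrams. -/
def IsScaledDiagram {m n : ℕ} (M : Op p m n) : Prop :=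
  ∃ (c : ℂ) (D : Diagram p m n), M = c • interp D

theorem isScaledDiagram_interp {m n : ℕ} (D : Diagram p m n) : IsScaledDiagram (interp D) :=
  ⟨1, D, (one_smul _ _).symm⟩

theorem IsScaledDiagram.comp {k m n : ℕ} {A : Op p m n} {B : Op p k m} (hA : IsScaledDiagram A)
    (hB : IsScaledDiagram B) : IsScaledDiagram (A * B) := by
  obtain ⟨a, D, rfl⟩ := hA
  obtain ⟨b, E, rfl⟩ := hB
  refine ⟨a * b, E.comp D, ?_⟩
  rw [interp, Matrix.smul_mul, Matrix.mul_smul, smul_smul]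

theorem IsScaledDiagram.tensor {m n m' n' : ℕ} {A : Op p m n} {B : Op p m' n'}
    (hA : IsScaledDiagram A) (hB : IsScaledDiagram B) : IsScaledDiagram (tensorOp A B) := by
  obtain ⟨a, D, rfl⟩ := hA
  obtain ⟨b, E, rfl⟩ := hB
  exact ⟨a * b, D.tensor E, tensorOp_smul_smul a b _ _⟩

theorem IsScaledDiagram.smul {m n : ℕ} {M : Op p m n} (hM : IsScaledDiagram M) (c : ℂ) :
    IsScaledDiagram (c • M) := by
  obtain ⟨a, D, rfl⟩ := hM
  exact ⟨c * a, D, smul_smul _ _ _⟩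

theorem isScaledDiagram_one (n : ℕ) : IsScaledDiagram (1 : Op p n n) :=
  isScaledDiagram_interp (.id n)

theorem isScaledDiagram_cast {m n : ℕ} (h : n = m) :
    IsScaledDiagram (funOp fun y : Basis p m => y ∘ Fin.cast h) := by
  subst h
  have : (funOp fun y : Basis p n => y ∘ Fin.cast rfl) = 1 := funOp_id n
  rw [this]
  exact isScaledDiagram_one n

theorem tensorOp_funOp {m n m' n' : ℕ} (f : Basis p m → Basis p n) (g : Basis p m' → Basis p n') :
    tensorOp (funOp f) (funOp g) = funOp fun y => Fin.append
      (f fun i => y (Fin.castAdd m' i)) (g fun i => y (Fin.natAdd m i)) := by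
  ext x y
  simp only [tensorOp_apply, funOp_apply, ← ite_and, mul_ite, mul_one, mul_zero]
  refine if_congr ⟨fun h => ?_, fun h => ?_⟩ rfl rfl
  · rw [← append_restrict x, h.1, h.2]
  · rw [h, append_castAdd, append_natAdd]
    exact ⟨rfl, rfl⟩

section Permutations

theorem isScaledDiagram_adjacent_swap {a b : ℕ} (j k : Fin (a + 2 + b)) (hj : j.val = a)
    (hk : k.val = a + 1) : IsScaledDiagram (funOp fun y : Basis p _ => y ∘ Equiv.swap j k) := by
  have h := ((isScaledDiagram_one (p := p) a).tensor (isScaledDiagram_interp .braid)).tensor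
    (isScaledDiagram_one b)
  rw [interp, swapOp_eq_funOp, ← funOp_id, ← funOp_id, tensorOp_funOp, tensorOp_funOp] at h
  convert h using 2
  ext y i
  have hj' : j = Fin.castAdd b (Fin.natAdd a 0) := Fin.ext (by simp [hj])
  have hk' : k = Fin.castAdd b (Fin.natAdd a 1) := Fin.ext (by simp [hk])
  refine Fin.addCases (fun i => ?_) (fun i => ?_) i
  · refine Fin.addCases (fun i => ?_) (fun i => ?_) i
    · rw [Function.comp_apply, Equiv.swap_apply_of_ne_of_ne]
      · simp
      · exact fun h => by have := congrArg Fin.val h; simp at this; omega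
      · exact fun h => by have := congrArg Fin.val h; simp at this; omega
    · fin_cases i
      · have : Equiv.swap j k (Fin.castAdd b (Fin.natAdd a 0)) = k := by
          rw [← hj', Equiv.swap_apply_left]
        refine (congrArg y this).trans ?_
        simp [hk']
      · have : Equiv.swap j k (Fin.castAdd b (Fin.natAdd a 1)) = j := by
          rw [← hk', Equiv.swap_apply_right]
        refine (congrArg y this).trans ?_
        simp [hj']
  · rw [Function.comp_apply, Equiv.swap_apply_of_ne_of_ne]
    · simp
    · exact fun h => by have := congrArg Fin.val h; simp at this; omega
    · exact fun h => by have := congrArg Fin.val h; simp at this; omega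

variable (p) in
/-- The permutations of the wires that are realised by diagrams. -/
def diagramPermutations (n : ℕ) : Submonoid (Equiv.Perm (Fin n)) where
  carrier := {σ | IsScaledDiagram (funOp fun y : Basis p n => y ∘ σ)}
  one_mem' := by
    have : (funOp fun y : Basis p n => y ∘ (1 : Equiv.Perm (Fin n))) = 1 := funOp_id n
    rw [Set.mem_ofPred_eq, this]
    exact isScaledDiagram_one n
  mul_mem' {σ τ} hσ hτ := by
    have := IsScaledDiagram.comp hτ hσ
    rwa [funOp_mul_funOp] at this

theorem isScaledDiagram_permutation {n : ℕ} (σ : Equiv.Perm (Fin n)) :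
    IsScaledDiagram (funOp fun y : Basis p n => y ∘ σ) := by
  suffices h : diagramPermutations p n = ⊤ by
    have : σ ∈ diagramPermutations p n := h ▸ Submonoid.mem_top σ
    exact this
  cases n with
  | zero =>
    refine eq_top_iff.2 fun τ _ => ?_
    rw [Subsingleton.elim τ 1]
    exact one_mem _
  | succ n =>
    rw [← top_le_iff, ← Equiv.Perm.mclosure_swap_castSucc_succ, Submonoid.closure_le]
    rintro _ ⟨i, rfl⟩
    obtain ⟨b, hb⟩ : ∃ b, n + 1 = i.val + 2 + b := ⟨n - 1 - i, by omega⟩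
    have key : ∀ (N : ℕ) (_ : N = i.val + 2 + b) (j k : Fin N), j.val = i → k.val = i + 1 →
        IsScaledDiagram (funOp fun y : Basis p N => y ∘ Equiv.swap j k) := by
      rintro N rfl j k hj hk
      exact isScaledDiagram_adjacent_swap j k hj hk
    exact key _ hb _ _ rfl rfl

end Permutations

section Phases

theorem isScaledDiagram_phaseOp_comp {n : ℕ} {q : Basis p n → ZMod p}
    (hq : IsScaledDiagram (phaseOp q)) (σ : Equiv.Perm (Fin n)) :
    IsScaledDiagram (phaseOp fun y => q (y ∘ σ)) := by
  have h := ((isScaledDiagram_permutation σ⁻¹).comp hq).comp (isScaledDiagram_permutation σ)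
  convert h using 1
  ext x y
  rw [mul_funOp_apply, phaseOp, phaseOp, Matrix.mul_diagonal, funOp_apply, Matrix.diagonal_apply,
    ite_mul, one_mul, zero_mul]
  have : (y ∘ σ) ∘ ⇑σ⁻¹ = y := by
    ext i
    simp
  rw [this]
  exact if_ctx_congr Iff.rfl (fun h => by rw [h]) fun _ => rfl

theorem isScaledDiagram_phaseOp_spider (a b : ZMod p) :
    IsScaledDiagram (phaseOp fun y : Basis p 1 => 2⁻¹ * (a * y 0 + b * y 0 ^ 2)) := by
  have h := (isScaledDiagram_interp (p := p) .greenMult).comp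
    ((isScaledDiagram_one 1).tensor (isScaledDiagram_interp (.greenUnit a b)))
  convert h using 1
  ext x y
  rw [interp, interp, greenOp_mult_eq, funOp_transpose_mul_apply, tensorOp_apply,
    greenOp_unit_apply, Matrix.one_apply, phaseOp, Matrix.diagonal_apply, ite_mul, one_mul,
    zero_mul]
  refine if_congr ?_ rfl rfl
  simp only [funext_iff, Fin.forall_fin_one]
  exact Iff.rfl

theorem isScaledDiagram_phaseOp_mul :
    IsScaledDiagram (phaseOp fun y : Basis p 2 => y 0 * y 1) := by
  have h1 := (isScaledDiagram_interp (p := p) .greenMult).comp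
    ((isScaledDiagram_interp .hadamard).tensor (isScaledDiagram_one 1))
  have h2 := (((isScaledDiagram_one 1).tensor h1).comp
    ((isScaledDiagram_interp .greenComult).tensor (isScaledDiagram_one 1))).smul (sqrtP p)
  convert h2 using 1
  ext x y
  rw [interp, interp, interp, greenOp_comult_eq, hadamard_eq_fourierOp, ← funOp_id,
    tensorOp_funOp, Matrix.smul_apply, mul_funOp_apply, tensorOp_apply, greenOp_mult_eq,
    funOp_transpose_mul_apply, tensorOp_apply, fourierOp_apply, funOp_apply, funOp_apply, phaseOp,
    Matrix.diagonal_apply]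
  have hxy : x = y ↔ x 0 = y 0 ∧ x 1 = y 1 := by simp [funext_iff, Fin.forall_fin_two]
  simp only [funext_iff, Fin.forall_fin_one, hxy, smul_eq_mul, one_mul]
  by_cases h0 : x 0 = y 0
  · by_cases h1 : x 1 = y 1
    · rw [if_pos ⟨h0, h1⟩, if_pos, if_pos]
      · have : ∀ u v : ZMod p, omegaPow p (u * v) =
            sqrtP p * (1 * (omegaPow p (v * u) / sqrtP p * 1)) := by
          intro u v
          rw [one_mul, mul_one, mul_div_cancel₀ _ sqrtP_ne_zero, mul_comm]
        rw [this, h0]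
        rfl
      · exact h1
      · exact h0
    · rw [if_neg (fun h => h1 h.2)]
      symm
      rw [if_neg (c := diagMap p 2 _ _ = _)]
      · simp
      · exact h1
  · rw [if_neg (fun h => h0 h.1)]
    symm
    rw [if_neg]
    · simp
    · exact h0

variable (p) in
/-- The exponents of the diagonal phase operators that are realised by diagrams up to a scalar. -/
def diagramPhases (n : ℕ) : AddSubmonoid (Basis p n → ZMod p) where
  carrier := {q | IsScaledDiagram (phaseOp q)}
  zero_mem' := by
    have : phaseOp (0 : Basis p n → ZMod p) = 1 := phaseOp_zero n
    rw [Set.mem_ofPred_eq, this]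
    exact isScaledDiagram_one n
  add_mem' {q r} hq hr := by
    have := IsScaledDiagram.comp hq hr
    rwa [phaseOp_mul_phaseOp] at this

theorem mul_mem_diagramPhases {n : ℕ} {q : Basis p n → ZMod p} (hq : q ∈ diagramPhases p n)
    (a : ZMod p) : (fun y => a * q y) ∈ diagramPhases p n := by
  have h := nsmul_mem hq a.val
  convert h using 1
  ext y
  simp

theorem tensorOp_one_phaseOp {m n : ℕ} (q : Basis p n → ZMod p) :
    tensorOp (1 : Op p m m) (phaseOp q) = phaseOp fun y => q fun i => y (Fin.natAdd m i) := by
  ext x y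
  simp only [tensorOp_apply, phaseOp, Matrix.one_apply, Matrix.diagonal_apply, ite_mul, one_mul,
    zero_mul, ← ite_and]
  refine if_congr ⟨fun h => ?_, fun h => by simp [h]⟩ rfl rfl
  rw [← append_restrict x, ← append_restrict y, h.1, h.2]

theorem spider_mem_diagramPhases {n : ℕ} (i : Fin n) (a b : ZMod p) :
    (fun y : Basis p n => 2⁻¹ * (a * y i + b * y i ^ 2)) ∈ diagramPhases p n := by
  cases n with
  | zero => exact i.elim0
  | succ n =>
    have h := (isScaledDiagram_one (p := p) n).tensor (isScaledDiagram_phaseOp_spider a b)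
    rw [tensorOp_one_phaseOp] at h
    have h' := isScaledDiagram_phaseOp_comp h (Equiv.swap (Fin.natAdd n 0) i)
    change IsScaledDiagram (phaseOp _)
    convert h' using 3
    simp

theorem mul_coord_mem_diagramPhases (hp : p ≠ 2) {n : ℕ} (i j : Fin n) :
    (fun y : Basis p n => y i * y j) ∈ diagramPhases p n := by
  by_cases hij : i = j
  · subst hij
    have h := spider_mem_diagramPhases i (0 : ZMod p) 2
    convert h using 2 with y
    field_simp [two_ne_zero_zmod hp]
    ring
  obtain ⟨n, rfl⟩ : ∃ k, n = k + 2 := by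
    refine ⟨n - 2, ?_⟩
    have := i.isLt
    have := j.isLt
    have := Fin.val_ne_of_ne hij
    omega
  have h := (isScaledDiagram_one (p := p) n).tensor isScaledDiagram_phaseOp_mul
  rw [tensorOp_one_phaseOp] at h
  set u : Fin (n + 2) := Fin.natAdd n 0
  set v : Fin (n + 2) := Fin.natAdd n 1
  have huv : v ≠ u := by simp [u, v]
  set t := Equiv.swap u i
  have hti : t u = i := Equiv.swap_apply_left _ _
  have htv : t v ≠ i := fun h => huv (t.injective (h.trans hti.symm))
  have h' := isScaledDiagram_phaseOp_comp h (Equiv.swap (t v) j * t)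
  change IsScaledDiagram (phaseOp _)
  convert h' using 4
  · change _ = (_ ∘ _) u
    rw [Function.comp_apply, Equiv.Perm.mul_apply, hti, Equiv.swap_apply_of_ne_of_ne htv.symm hij]
  · change _ = (_ ∘ _) v
    rw [Function.comp_apply, Equiv.Perm.mul_apply, Equiv.swap_apply_left]

theorem IsQuadratic.isScaledDiagram_phaseOp (hp : p ≠ 2) {n : ℕ} {q : Basis p n → ZMod p}
    (hq : IsQuadratic q) : IsScaledDiagram (phaseOp q) := by
  obtain ⟨Q, l, c, hq⟩ := hq
  have h2 := two_ne_zero_zmod hp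
  let _ : Invertible (2 : ZMod p) := invertibleOfNonzero h2
  have hQ : (fun y => Q y) ∈ diagramPhases p n := by
    set B := QuadraticMap.associated (R := ZMod p) Q
    set e : Fin n → Basis p n := fun i j => if i = j then 1 else 0
    have : (fun y => Q y) = ∑ i, ∑ j, fun y => B (e i) (e j) * (y i * y j) := by
      ext y
      simp only [Finset.sum_apply]
      rw [← QuadraticMap.associated_eq_self_apply (ZMod p) Q y, LinearMap.pi_apply_eq_sum_univ B y]
      simp only [LinearMap.sum_apply, LinearMap.smul_apply]
      refine sum_congr rfl fun i _ => ?_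
      rw [LinearMap.pi_apply_eq_sum_univ (B (e i)) y, smul_sum]
      refine sum_congr rfl fun j _ => ?_
      simp only [smul_eq_mul]
      ring
    rw [this]
    exact sum_mem fun i _ => sum_mem fun j _ =>
      mul_mem_diagramPhases (mul_coord_mem_diagramPhases hp i j) _
  have hl : (fun y => l y) ∈ diagramPhases p n := by
    set e : Fin n → Basis p n := fun i j => if i = j then 1 else 0
    have : (fun y => l y) = ∑ i, fun y => 2⁻¹ * (2 * l (e i) * y i + 0 * y i ^ 2) := by
      ext y
      simp only [Finset.sum_apply]
      rw [LinearMap.pi_apply_eq_sum_univ l y]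
      refine sum_congr rfl fun i _ => ?_
      rw [smul_eq_mul]
      field_simp
      ring
    rw [this]
    exact sum_mem fun i _ => spider_mem_diagramPhases i _ _
  have h : IsScaledDiagram (phaseOp fun y => Q y + l y) := add_mem hQ hl
  have h' := h.smul (omegaPow p c)
  convert h' using 1
  simp only [phaseOp, ← Matrix.diagonal_smul]
  congr 1
  ext y
  rw [hq, omegaPow_add, mul_comm]
  rfl

end Phases

theorem isScaledDiagram_ones (n : ℕ) :
    IsScaledDiagram (Matrix.of fun _ _ => 1 : Op p 0 n) ∧
      IsScaledDiagram (Matrix.of fun _ _ => 1 : Op p n 0) := by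
  induction n with
  | zero =>
    have : (Matrix.of fun _ _ => 1 : Op p 0 0) = 1 := by
      ext x y
      rw [Subsingleton.elim x y]
      simp
    rw [this]
    exact ⟨isScaledDiagram_one 0, isScaledDiagram_one 0⟩
  | succ n ih =>
    constructor
    · convert ih.1.tensor (isScaledDiagram_interp (.greenUnit 0 0)) using 1
      ext x y
      simp [tensorOp_apply, interp, greenOp_unit_apply, spiderPhase_zero]
    · convert ih.2.tensor (isScaledDiagram_interp (.greenCounit 0 0)) using 1
      ext x y
      simp [tensorOp_apply, interp, greenOp_counit_apply, spiderPhase_zero]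

theorem IsGaussianOp.isScaledDiagram (hp : p ≠ 2) {m n : ℕ} {M : Op p m n} (hM : IsGaussianOp M) :
    IsScaledDiagram M := by
  obtain ⟨W, _, _, _, c, q, -, hq, h⟩ := hM
  set k := Module.finrank (ZMod p) W
  set e : W ≃ₗ[ZMod p] Basis p k := (Module.finBasis (ZMod p) W).equivFun
  let x : Basis p (n + (m + k)) →ₗ[ZMod p] Basis p n :=
    LinearMap.funLeft (ZMod p) (ZMod p) (Fin.castAdd (m + k))
  let y : Basis p (n + (m + k)) →ₗ[ZMod p] Basis p m :=
    LinearMap.funLeft (ZMod p) (ZMod p) fun i => Fin.natAdd n (Fin.castAdd k i)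
  let u : Basis p (n + (m + k)) →ₗ[ZMod p] Basis p k :=
    LinearMap.funLeft (ZMod p) (ZMod p) fun i => Fin.natAdd n (Fin.natAdd m i)
  have hq' := (hq.comp ((x.prod y).prod (e.symm.toLinearMap.comp u))).isScaledDiagram_phaseOp hp
  have hE := (isScaledDiagram_one (p := p) n).tensor (isScaledDiagram_ones (m + k)).2
  have hF := ((isScaledDiagram_ones (p := p) n).1.tensor ((isScaledDiagram_one m).tensor
    (isScaledDiagram_ones k).1)).comp
      (isScaledDiagram_cast (p := p) (show 0 + (m + 0) = m by omega))
  have key : ∀ N : Op p m n, IsScaledDiagram N → M = N → IsScaledDiagram M := fun N hN h => h ▸ hN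
  refine key _ (((hE.comp hq').comp hF).smul c) ?_
  ext x' y'
  have hy : (fun i => (y' ∘ Fin.cast (show 0 + (m + 0) = m by omega))
      (Fin.natAdd 0 (Fin.castAdd 0 i))) = y' := by
    ext i
    exact congrArg y' (Fin.ext (by simp))
  have hz : ∀ (v : Basis p n) (a : Basis p m) (b : Basis p k),
      (fun i => Fin.append v (Fin.append a b) (Fin.natAdd n (Fin.castAdd k i))) = a := by
    intro v a b
    ext i
    simp
  have hx : (fun i => x' (Fin.castAdd 0 i)) = x' := rfl
  refine (h (x', y')).trans (congrArg (c * ·) ?_)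
  rw [Matrix.mul_apply]
  simp only [mul_funOp_apply, phaseOp, Matrix.mul_diagonal, tensorOp_apply, sum_basis_add,
    append_castAdd, Matrix.of_apply, Matrix.one_apply, mul_one, one_mul, hy, hz, hx]
  rw [sum_eq_single x']
  · rw [sum_eq_single y']
    · rw [← e.symm.toEquiv.sum_comp]
      refine sum_congr rfl fun w _ => ?_
      rw [if_pos rfl, if_pos rfl, one_mul, mul_one]
      congr 2
      simp [x, y, u, LinearMap.funLeft, Function.comp_def]
    · intro v _ hv
      simp [hv]
    · simp
  · intro v _ hv
    simp [hv.symm]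
  · simp

end ScaledDiagrams

section CliffordAmplitudes

variable {p : ℕ} [Fact p.Prime]

theorem IsGaussian.translate {V : Type} [AddCommGroup V] [Module (ZMod p) V] {f : V → ℂ}
    (hf : IsGaussian p f) (v₀ : V) : IsGaussian p fun v => f (v₀ + v) := by
  obtain ⟨W, _, _, _, c, q, hc, hq, h⟩ := hf
  refine ⟨W, _, _, inferInstance, c, _, hc, hq.translate (v₀, 0), fun v => ?_⟩
  simp [h]

theorem pauli_apply {n : ℕ} (k : ZMod p) (a b x y : Basis p n) :
    pauli k a b x y = if x = y + a then omegaPow p (k + b ⬝ᵥ y) else 0 := rfl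

theorem pauli_mul_pauli {n : ℕ} (k l : ZMod p) (a b c d : Basis p n) :
    pauli k a b * pauli l c d = pauli (k + l + b ⬝ᵥ c) (a + c) (b + d) := by
  ext x y
  rw [mul_pauli_apply, pauli_apply, pauli_apply, ite_mul, zero_mul, ← omegaPow_add,
    dotProduct_add, add_dotProduct, add_assoc y c a, add_comm c a]
  congr 2
  ring

theorem smul_pauli {n : ℕ} (k l : ZMod p) (a b : Basis p n) :
    omegaPow p k • pauli l a b = pauli (k + l) a b := by
  ext x y
  rw [Matrix.smul_apply, smul_eq_mul, pauli_apply, pauli_apply, mul_ite, mul_zero,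
    ← omegaPow_add, add_assoc]

theorem pauli_injective {n : ℕ} {k l : ZMod p} {a b c d : Basis p n}
    (h : pauli k a b = pauli l c d) : k = l ∧ a = c ∧ b = d := by
  have hy : ∀ y, y + a = y + c ∧ k + b ⬝ᵥ y = l + d ⬝ᵥ y := by
    intro y
    have := congrFun (congrFun h (y + a)) y
    rw [pauli_apply, pauli_apply, if_pos rfl] at this
    split_ifs at this with h1
    · exact ⟨h1, omegaPow_injective this⟩
    · exact absurd this (omegaPow_ne_zero _)
  have hk : k = l := by simpa using (hy 0).2
  refine ⟨hk, by simpa using (hy 0).1, ?_⟩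
  subst hk
  exact dotProduct_eq _ _ fun y => add_left_cancel (hy y).2

theorem isQuadratic_dotProduct {V : Type} [AddCommGroup V] [Module (ZMod p) V] {n : ℕ}
    (f g : V →ₗ[ZMod p] Basis p n) : IsQuadratic fun v => f v ⬝ᵥ g v :=
  IsQuadratic.sum univ fun i =>
    IsQuadratic.linear_mul ((LinearMap.proj i).comp f) ((LinearMap.proj i).comp g)

theorem isQuadratic_of_map_add (hp : p ≠ 2) {V : Type} [AddCommGroup V] [Module (ZMod p) V]
    {n : ℕ} (f g f' g' : V →ₗ[ZMod p] Basis p n) {k : V → ZMod p}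
    (h : ∀ s t, k (s + t) = k s + k t + f s ⬝ᵥ g t - f' s ⬝ᵥ g' t) : IsQuadratic k := by
  have h2 := two_ne_zero_zmod hp
  let β : V → V → ZMod p := fun s t => f s ⬝ᵥ g t - f' s ⬝ᵥ g' t
  have hβ : ∀ s t, β s t = β t s := by
    intro s t
    have h1 := h s t
    rw [add_comm, h t s] at h1
    simp only [β]
    linear_combination -h1
  let l : V →+ ZMod p := AddMonoidHom.mk' (fun s => k s - 2⁻¹ * β s s) fun s t => by
    have hst : β (s + t) (s + t) = β s s + β t t + 2 * β s t := by
      have : β (s + t) (s + t) = β s s + β s t + β t s + β t t := by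
        simp only [β, map_add, add_dotProduct, dotProduct_add]
        ring
      rw [this, hβ t s]
      ring
    rw [hst, h]
    simp only [β]
    field_simp
    ring
  have hk := (IsQuadratic.linear (l.toZModLinearMap p)).add
    (((isQuadratic_dotProduct f g).add (isQuadratic_dotProduct f' g').neg).smul 2⁻¹)
  convert hk using 2 with s
  change k s = k s - 2⁻¹ * β s s + 2⁻¹ * (f s ⬝ᵥ g s + -(f' s ⬝ᵥ g' s))
  simp only [β]
  ring

theorem IsClifford.exists_conjugation (hp : p ≠ 2) {n : ℕ} {U : Op p n n} (hU : IsClifford U) :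
    ∃ (k : Basis p n × Basis p n → ZMod p) (A B : Basis p n × Basis p n →ₗ[ZMod p] Basis p n),
      IsQuadratic k ∧
        ∀ s, U * pauli 0 s.1 s.2 * U.conjTranspose = pauli (k s) (A s) (B s) := by
  have hex : ∀ s : Basis p n × Basis p n, ∃ k a b,
      U * pauli 0 s.1 s.2 * U.conjTranspose = pauli k a b := fun s => hU.2 _ ⟨0, s.1, s.2, rfl⟩
  choose k A B h using hex
  have hUU : U.conjTranspose * U = 1 := Matrix.mem_unitaryGroup_iff'.1 hU.1
  have hadd : ∀ s t, k s + k t + B s ⬝ᵥ A t = s.2 ⬝ᵥ t.1 + k (s + t) ∧ A s + A t = A (s + t) ∧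
      B s + B t = B (s + t) := by
    intro s t
    refine pauli_injective ?_
    rw [← pauli_mul_pauli, ← smul_pauli, ← h, ← h, ← h]
    calc U * pauli 0 s.1 s.2 * U.conjTranspose * (U * pauli 0 t.1 t.2 * U.conjTranspose)
        = U * (pauli 0 s.1 s.2 * ((U.conjTranspose * U) * pauli 0 t.1 t.2)) *
            U.conjTranspose := by simp only [Matrix.mul_assoc]
      _ = U * (pauli 0 s.1 s.2 * pauli 0 t.1 t.2) * U.conjTranspose := by
          rw [hUU, Matrix.one_mul]
      _ = _ := by
          have : pauli 0 s.1 s.2 * pauli 0 t.1 t.2 =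
              omegaPow p (s.2 ⬝ᵥ t.1) • pauli 0 (s + t).1 (s + t).2 := by
            rw [pauli_mul_pauli, smul_pauli]
            simp
          rw [this, Matrix.mul_smul, Matrix.smul_mul]
  let A' := (AddMonoidHom.mk' A fun s t => (hadd s t).2.1.symm).toZModLinearMap p
  let B' := (AddMonoidHom.mk' B fun s t => (hadd s t).2.2.symm).toZModLinearMap p
  refine ⟨k, A', B', isQuadratic_of_map_add hp B' A' (LinearMap.snd _ _ _) (LinearMap.fst _ _ _)
    fun s t => ?_, h⟩
  have := (hadd s t).1
  change k (s + t) = k s + k t + B s ⬝ᵥ A t - s.2 ⬝ᵥ t.1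
  linear_combination -this

theorem sum_omegaPow_dotProduct {n : ℕ} (v : Basis p n) :
    ∑ b : Basis p n, omegaPow p (b ⬝ᵥ v) = if v = 0 then (p : ℂ) ^ n else 0 := by
  simp only [dotProduct, omegaPow_sum]
  have hprod := prod_univ_sum (fun _ : Fin n => (univ : Finset (ZMod p)))
    fun i k => omegaPow p (k * v i)
  rw [Fintype.piFinset_univ] at hprod
  rw [← hprod]
  simp only [sum_omegaPow_mul, prod_ite_zero, prod_const, card_univ, Fintype.card_fin, mem_univ,
    true_implies, funext_iff, Pi.zero_apply]

theorem sum_pauli_eq {n : ℕ} (y : Basis p n) :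
    ∑ b, pauli 0 y b = Matrix.single y 0 ((p : ℂ) ^ n) := by
  ext u v
  rw [Matrix.sum_apply, Matrix.single_apply]
  simp only [pauli_apply, zero_add]
  by_cases hu : u = v + y
  · simp only [if_pos hu, sum_omegaPow_dotProduct]
    refine if_congr ⟨fun h => ?_, fun h => h.2.symm⟩ rfl rfl
    subst h
    exact ⟨by rw [hu, zero_add], rfl⟩
  · simp only [if_neg hu, sum_const_zero]
    rw [if_neg]
    rintro ⟨rfl, rfl⟩
    exact hu (zero_add _).symm

theorem mul_single_mul_apply {n : ℕ} (U V : Op p n n) (y z : Basis p n) (c : ℂ)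
    (x x' : Basis p n) : (U * Matrix.single y z c * V) x x' = U x y * c * V z x' := by
  rw [Matrix.mul_apply, sum_eq_single z]
  · rw [Matrix.mul_single_apply_same]
  · intro w _ hw
    rw [Matrix.mul_single_apply_of_ne (hbj := hw), zero_mul]
  · simp

theorem IsClifford.exists_eq_smul_gaussian (hp : p ≠ 2) {n : ℕ} {U : Op p n n}
    (hU : IsClifford U) : ∃ (c : ℂ) (M : Op p n n), IsGaussianOp M ∧ U = c • M := by
  obtain ⟨k, A, B, hk, h⟩ := hU.exists_conjugation hp
  have hUU : U.conjTranspose * U = 1 := Matrix.mem_unitaryGroup_iff'.1 hU.1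
  obtain ⟨z, hz⟩ : ∃ z, U z 0 ≠ 0 := by
    by_contra! h0
    have := congrFun (congrFun hUU 0) 0
    simp [Matrix.mul_apply, h0] at this
  set d : ℂ := (p : ℂ) ^ n * star (U z 0) with hd
  have hp0 : (p : ℂ) ≠ 0 := by exact_mod_cast (Fact.out : p.Prime).ne_zero
  have hd0 : d ≠ 0 := mul_ne_zero (pow_ne_zero _ hp0) (star_ne_zero.2 hz)
  have hsum : ∀ x y, U x y * d = ∑ b, pauli (k (y, b)) (A (y, b)) (B (y, b)) x z := by
    intro x y
    have := mul_single_mul_apply U U.conjTranspose y 0 ((p : ℂ) ^ n) x z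
    rw [← sum_pauli_eq, Matrix.mul_sum, Matrix.sum_mul, Matrix.sum_apply,
      Matrix.conjTranspose_apply] at this
    rw [hd, ← mul_assoc, ← this]
    exact sum_congr rfl fun b _ => by rw [h (y, b)]
  refine ⟨d⁻¹, d • U, ?_, by rw [smul_smul, inv_mul_cancel₀ hd0, one_smul]⟩
  let s : (Basis p n × Basis p n) × Basis p n →ₗ[ZMod p] Basis p n × Basis p n :=
    ((LinearMap.snd _ _ _).comp (LinearMap.fst _ _ _)).prod (LinearMap.snd _ _ _)
  let x : (Basis p n × Basis p n) × Basis p n →ₗ[ZMod p] Basis p n :=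
    (LinearMap.fst _ _ _).comp (LinearMap.fst _ _ _)
  have h1 := IsGaussian.ite_eq_pi x (A.comp s)
  have h2 := IsGaussian.omegaPow ((hk.comp s).add (IsQuadratic.linear
    (((dotProductEquiv (ZMod p) (Fin n)) z).comp (B.comp s))))
  have h3 := ((h1.mul h2).sum).translate (-z, 0)
  unfold IsGaussianOp
  convert h3 using 2 with v
  rw [Matrix.smul_apply, smul_eq_mul, mul_comm, hsum]
  refine sum_congr rfl fun b => ?_
  intro _
  have hv : s ((-z, 0) + v, b) = (v.2, b) := by simp [s]
  have hx : x ((-z, 0) + v, b) = -z + v.1 := rfl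
  simp only [LinearMap.comp_apply, hv, hx, pauli_apply, ite_mul, one_mul, zero_mul,
    neg_add_eq_iff_eq_add]
  refine if_congr Iff.rfl ?_ rfl
  rw [dotProduct_comm]
  rfl

theorem IsClifford.isScaledDiagram (hp : p ≠ 2) {n : ℕ} {U : Op p n n} (hU : IsClifford U) :
    IsScaledDiagram U := by
  obtain ⟨c, M, hM, rfl⟩ := hU.exists_eq_smul_gaussian hp
  exact (hM.isScaledDiagram hp).smul c

theorem Generated.isScaledDiagram (hp : p ≠ 2) {m n : ℕ} {M : Op p m n} (hM : Generated M) :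
    IsScaledDiagram M := by
  have h0 := isGaussianOp_funOp (0 : Basis p 0 →ₗ[ZMod p] Basis p 1)
  induction hM with
  | id n => exact isScaledDiagram_one n
  | swap => exact isScaledDiagram_interp .braid
  | state =>
    rw [state_eq_funOp]
    exact h0.isScaledDiagram hp
  | effect =>
    rw [effect_eq_funOp_transpose]
    exact IsGaussianOp.isScaledDiagram hp (IsGaussian.comp h0
      (LinearEquiv.prodComm (ZMod p) (Basis p 0) (Basis p 1)).toLinearMap)
  | clifford U hU =>
    obtain ⟨l, -, V, hV, -, rfl⟩ := hU
    exact (hV.isScaledDiagram hp).smul l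
  | scalar z hz => exact IsGaussianOp.isScaledDiagram hp (IsGaussian.const hz)
  | comp A B hA hB ihA ihB => exact ihB.comp ihA
  | tensor A B hA hB ihA ihB => exact ihA.tensor ihB

end CliffordAmplitudes

section ScalarDiagrams

variable {p : ℕ} [Fact p.Prime]

variable (p) in
/-- The scalars that are interpretations of diagrams. -/
def diagramScalars : Submonoid ℂ where
  carrier := {z | ∃ D : Diagram p 0 0, interp D = scalarOp z}
  one_mem' := ⟨.id 0, by
    ext x y
    rw [Subsingleton.elim x y]
    simp [interp, scalarOp]⟩
  mul_mem' {z w} := by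
    rintro ⟨D, hD⟩ ⟨E, hE⟩
    refine ⟨E.comp D, ?_⟩
    rw [interp, hD, hE]
    ext x y
    simp [Matrix.mul_apply, scalarOp]

/-- The value of a one-wire diagram closed by a green unit and a green counit. -/
theorem sandwich_mem_diagramScalars (D : Diagram p 1 1) (a b a' b' : ZMod p) :
    ∑ x, ∑ y, spiderPhase a b y * interp D (fun _ => x) (fun _ => y) * spiderPhase a' b' x ∈
      diagramScalars p := by
  refine ⟨(Diagram.comp (.greenUnit a b) D).comp (.greenCounit a' b'), ?_⟩
  ext u v
  simp only [interp, Matrix.mul_apply, sum_basis_one, greenOp_unit_apply, greenOp_counit_apply,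
    scalarOp, Matrix.of_apply, mul_sum]
  exact sum_congr rfl fun x _ => sum_congr rfl fun y _ => by ring

theorem sqrtP_mul_omegaPow_mem_diagramScalars (hp : p ≠ 2) (c : ZMod p) :
    sqrtP p * omegaPow p c ∈ diagramScalars p := by
  have h2 := two_ne_zero_zmod hp
  have h := sandwich_mem_diagramScalars (p := p) .hadamard (-2) 0 (2 * c) 0
  convert h using 1
  have hterm : ∀ x y : ZMod p, spiderPhase (-2) 0 y *
      interp (.hadamard : Diagram p 1 1) (fun _ => x) (fun _ => y) * spiderPhase (2 * c) 0 x =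
        (sqrtP p)⁻¹ * omegaPow p (c * x) * omegaPow p (y * (x - 1)) := by
    intro x y
    rw [interp, hadamard_eq_fourierOp, fourierOp_apply, spiderPhase, spiderPhase,
      div_eq_mul_inv]
    have : 2⁻¹ * (-2 * y + 0 * y ^ 2) = -y ∧ 2⁻¹ * (2 * c * x + 0 * x ^ 2) = c * x := by
      constructor <;> field_simp <;> ring
    rw [this.1, this.2, show y * (x - 1) = -y + 1 * (x * y) by ring, omegaPow_add]
    ring
  simp only [hterm, ← mul_sum, sum_omegaPow_mul, sub_eq_zero]
  simp only [mul_ite, mul_zero, sum_ite_eq', mem_univ, if_true, mul_one]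
  rw [← sqrtP_mul_self]
  field_simp [sqrtP_ne_zero]

theorem interp_schur (D E : Diagram p 1 1) :
    ∃ F : Diagram p 1 1, ∀ x y, interp F x y = interp D x y * interp E x y := by
  refine ⟨(Diagram.comp .greenComult (D.tensor E)).comp .greenMult, fun x y => ?_⟩
  rw [interp, interp, interp, interp, interp, greenOp_mult_eq, greenOp_comult_eq,
    funOp_transpose_mul_apply, mul_funOp_apply, tensorOp_apply]
  have : ∀ z : Basis p 1, (fun _ : Fin 1 => z 0) = z := fun z => by
    ext i
    rw [Subsingleton.elim i 0]
  exact congrArg₂ (· * ·) (congrArg₂ (interp D) (this x) (this y))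
    (congrArg₂ (interp E) (this x) (this y))

theorem interp_antipode_apply (x y : Basis p 1) :
    interp (.antipode : Diagram p 1 1) x y = if x 0 + y 0 = 0 then 1 else 0 := by
  have hp0 : (p : ℂ) ≠ 0 := by exact_mod_cast (Fact.out : p.Prime).ne_zero
  rw [interp, redOp_apply]
  have h : ∀ k : ZMod p, spiderPhase 0 0 k * omegaPow p (-k * (∑ i, x i + ∑ i, y i)) =
      omegaPow p (k * -(x 0 + y 0)) := by
    intro k
    rw [spiderPhase_zero, one_mul, Fin.sum_univ_one, Fin.sum_univ_one]
    congr 1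
    ring
  simp only [h, sum_omegaPow_mul, neg_eq_zero, pow_one]
  rw [← mul_inv, sqrtP_mul_self, mul_ite, mul_zero, inv_mul_cancel₀ hp0]

theorem interp_hadamard_antipode (x y : Basis p 1) :
    interp (Diagram.comp .antipode .hadamard : Diagram p 1 1) x y =
      omegaPow p (-(x 0 * y 0)) / sqrtP p := by
  rw [interp, Matrix.mul_apply, sum_basis_one, sum_eq_single (-y 0)]
  · rw [interp_antipode_apply, if_pos (neg_add_cancel _), mul_one, interp, hadamard_eq_fourierOp,
      fourierOp_apply]
    congr 2
    ring
  · intro k _ hk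
    rw [interp_antipode_apply, if_neg (fun h => hk (eq_neg_of_add_eq_zero_left h)), mul_zero]
  · simp

theorem inv_sqrtP_mem_diagramScalars : (sqrtP p)⁻¹ ∈ diagramScalars p := by
  obtain ⟨F, hF⟩ := interp_schur (p := p) .hadamard (.comp .antipode .hadamard)
  obtain ⟨G, hG⟩ := interp_schur (p := p) .hadamard F
  have h := sandwich_mem_diagramScalars G 0 0 0 0
  convert h using 1
  have hterm : ∀ x y : ZMod p, spiderPhase 0 0 y * interp G (fun _ => x) (fun _ => y) *
      spiderPhase 0 0 x = (sqrtP p)⁻¹ ^ 3 * omegaPow p (y * x) := by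
    intro x y
    rw [hG, hF, interp_hadamard_antipode, interp, hadamard_eq_fourierOp, fourierOp_apply,
      spiderPhase_zero, spiderPhase_zero, omegaPow_neg, one_mul, one_mul, mul_one, mul_comm x y]
    field_simp [omegaPow_ne_zero, sqrtP_ne_zero]
  simp only [hterm, ← mul_sum, sum_omegaPow_mul]
  simp only [sum_ite_eq', mem_univ, if_true]
  rw [← sqrtP_mul_self]
  field_simp [sqrtP_ne_zero]

theorem sqrtP_mem_diagramScalars (hp : p ≠ 2) : sqrtP p ∈ diagramScalars p := by
  simpa [omegaPow_zero] using sqrtP_mul_omegaPow_mem_diagramScalars hp (0 : ZMod p)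

theorem omegaPow_mem_diagramScalars (hp : p ≠ 2) (c : ZMod p) :
    omegaPow p c ∈ diagramScalars p := by
  have := mul_mem inv_sqrtP_mem_diagramScalars (sqrtP_mul_omegaPow_mem_diagramScalars hp c)
  rwa [inv_mul_cancel_left₀ sqrtP_ne_zero] at this

theorem neg_one_mem_diagramScalars : (-1 : ℂ) ∈ diagramScalars p := ⟨.star, rfl⟩

theorem zero_mem_diagramScalars (hp : p ≠ 2) : (0 : ℂ) ∈ diagramScalars p := by
  have h2 := two_ne_zero_zmod hp
  have h := sandwich_mem_diagramScalars (p := p) (.id 1) 2 0 0 0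
  convert h using 1
  have hterm : ∀ x : ZMod p, ∑ y, spiderPhase 2 0 y *
      interp (.id 1 : Diagram p 1 1) (fun _ => x) (fun _ => y) * spiderPhase 0 0 x =
        omegaPow p (x * 1) := by
    intro x
    rw [sum_eq_single x]
    · rw [interp, Matrix.one_apply_eq, spiderPhase_zero, mul_one, mul_one, spiderPhase]
      congr 1
      field_simp
      ring
    · intro y _ hy
      rw [interp, Matrix.one_apply_ne, mul_zero, zero_mul]
      exact fun h => hy (congrFun h 0).symm
    · simp
  simp only [hterm, sum_omegaPow_mul, if_neg (one_ne_zero (α := ZMod p))]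

theorem gauss_mem_diagramScalars (hp : p ≠ 2) :
    ∑ k : ZMod p, omegaPow p (1 * k ^ 2) ∈ diagramScalars p := by
  have h2 := two_ne_zero_zmod hp
  have h := sandwich_mem_diagramScalars (p := p) (.id 1) 0 2 0 0
  convert h using 1
  refine sum_congr rfl fun x _ => ?_
  rw [sum_eq_single x]
  · rw [interp, Matrix.one_apply_eq, spiderPhase_zero, mul_one, mul_one, spiderPhase]
    congr 1
    field_simp
    ring
  · intro y _ hy
    rw [interp, Matrix.one_apply_ne, mul_zero, zero_mul]
    exact fun h => hy (congrFun h 0).symm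
  · simp

theorem phaseUnit_mem_diagramScalars (hp : p ≠ 2) : phaseUnit p ∈ diagramScalars p := by
  unfold phaseUnit
  split_ifs with h4
  · exact neg_one_mem_diagramScalars
  have h := sum_omegaPow_sq_sq hp (one_ne_zero (α := ZMod p))
  rw [if_neg h4, ← sqrtP_mul_self] at h
  have hmem := mul_mem inv_sqrtP_mem_diagramScalars (gauss_mem_diagramScalars hp)
  set g := ∑ k : ZMod p, omegaPow p (1 * k ^ 2)
  have : g ^ 2 = (Complex.I * sqrtP p) ^ 2 := by
    rw [h, mul_pow, Complex.I_sq]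
    ring
  rw [sq_eq_sq_iff_eq_or_eq_neg] at this
  rcases this with h | h <;> rw [h] at hmem
  · rwa [mul_comm, mul_inv_cancel_right₀ sqrtP_ne_zero] at hmem
  · have := mul_mem neg_one_mem_diagramScalars hmem
    rwa [neg_one_mul, mul_neg, neg_neg, mul_comm, mul_inv_cancel_right₀ sqrtP_ne_zero] at this

theorem zpow_mem_diagramScalars {z : ℂ} (hz : z ∈ diagramScalars p)
    (hz' : z⁻¹ ∈ diagramScalars p) (r : ℤ) : z ^ r ∈ diagramScalars p := by
  cases r with
  | ofNat r => simpa using pow_mem hz r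
  | negSucc r => simpa [zpow_negSucc, inv_pow] using pow_mem hz' (r + 1)

theorem mem_diagramScalars_of_mem_scalarMonoid (hp : p ≠ 2) {z : ℂ} (hz : z ∈ scalarMonoid p) :
    z ∈ diagramScalars p := by
  rcases mem_scalarMonoid_iff.1 hz with rfl | ⟨r, l, hl, rfl⟩
  · exact zero_mem_diagramScalars hp
  refine mul_mem (zpow_mem_diagramScalars (sqrtP_mem_diagramScalars hp)
    inv_sqrtP_mem_diagramScalars r) ?_
  obtain ⟨s, a, rfl⟩ := mem_phaseGroup_iff.1 hl
  refine mul_mem (zpow_mem_diagramScalars (phaseUnit_mem_diagramScalars hp) ?_ s)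
    (omegaPow_mem_diagramScalars hp a)
  have : (phaseUnit p)⁻¹ = phaseUnit p ^ 3 := by
    unfold phaseUnit
    split_ifs
    · norm_num
    · rw [Complex.inv_I, Complex.I_pow_three]
  rw [this]
  exact pow_mem (phaseUnit_mem_diagramScalars hp) 3

theorem exists_diagram_smul (hp : p ≠ 2) {m n : ℕ} (D : Diagram p m n) {z : ℂ}
    (hz : z ∈ scalarMonoid p) : ∃ E : Diagram p m n, interp E = z • interp D := by
  obtain ⟨F, hF⟩ := mem_diagramScalars_of_mem_scalarMonoid hp hz
  refine ⟨D.tensor F, ?_⟩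
  rw [interp, hF]
  exact tensorOp_scalarOp _ _

theorem IsStabiliserOperation.exists_diagram (hp : p ≠ 2) {m n : ℕ} {C : Op p m n}
    (hC : IsStabiliserOperation C) : ∃ D : Diagram p m n, interp D = C := by
  obtain ⟨c, D, rfl⟩ := hC.1.isScaledDiagram hp
  by_cases h0 : c • interp D = 0
  · obtain ⟨E, hE⟩ := exists_diagram_smul hp D zero_mem_scalarMonoid
    exact ⟨E, by rw [hE, h0, zero_smul]⟩
  obtain ⟨x, y, hxy⟩ : ∃ x y, (c • interp D) x y ≠ 0 := by
    by_contra! h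
    exact h0 (Matrix.ext h)
  have hne : interp D x y ≠ 0 := right_ne_zero_of_mul hxy
  have hc := scalarMonoid_mul (hC.2 x y)
    (scalarMonoid_inv ((isStabiliserOperation_interp hp D).2 x y))
  rw [Matrix.smul_apply, smul_eq_mul, mul_inv_cancel_right₀ hne] at hc
  exact exists_diagram_smul hp D hc

end ScalarDiagrams

end QupitZX

end

theorem mainTheorem7 (p : ℕ) [Fact p.Prime] (hp : p ≠ 2) :
    (∀ (m n : ℕ) (D : QupitZX.Diagram p m n),
      QupitZX.IsStabiliserOperation (QupitZX.interp D)) ∧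
    (∀ (m n : ℕ) (C : QupitZX.Op p m n), QupitZX.IsStabiliserOperation C →
      ∃ D : QupitZX.Diagram p m n, QupitZX.interp D = C) :=
  ⟨fun _ _ D => QupitZX.isStabiliserOperation_interp hp D, fun _ _ _ hC => hC.exists_diagram hp⟩
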